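/- Let $G$ be a group with a finite type Garside structure $(G,P,\Delta)$. That is: $G$ carries a lattice order $\preceq$ (with gcd $\wedge$ and lcm $\vee$) that is invariant under left multiplication; $P=\{x\in G: 1\preceq x\}$ is its positive cone; $\Delta\in P$ is such that the set $[1,\Delta]=\{s\in G: 1\preceq s\preceq\Delta\}$ of simple elements is finite and generates $G$, and $\Delta^{-1}P\Delta=P$; and $P$ is atomic, that is, for every $x\in P$ the lengths $r$ of strict chains $1\prec x_1\prec\cdots\prec x_r=x$ are bounded. Put $\tau(x)=\Delta^{-1}x\Delta$. The left normal form of $X\in G$ is its unique decomposition $X=\Delta^p x_1\cdots x_r$ with $p\in\mathbb Z$, $r\ge 0$, $x_i\neq 1$, $x_1\cdots x_r\in P$, $\Delta\not\preceq x_1\cdots x_r$, and $x_i=(x_i\cdots x_r)\wedge\Delta$ for all $i$. The canonical length is $\ell(X)=r$. If $r>0$, the cycling of $X$ is $\mathbf c(X)=\iota(X)^{-1}X\,\iota(X)$ with $\iota(X)=\tau^{-p}(x_1)$; if $r=0$, $\mathbf c(X)=X$. The super summit set $SSS(X)$ is the set of conjugates of $X$ of minimal canonical length, and the ultra summit set is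 $USS(X)=\{Y\in SSS(X): \mathbf c^m(Y)=Y \text{ for some } m>0\}$. The element $X$ is rigid if $r>0$ and $\Delta^p x_1\cdots x_r\,\tau^{-p}(x_1)$ is in left normal form as written; $X$ has a rigid power if $X^m$ is rigid for some integer $m\neq 0$. Theorem. Let $X\in USS(X)$ with $\ell(X)>1$. If $X$ has a rigid power, then every element of $USS(X)$ has a rigid power. -/

import Mathlib

/-! A lattice-ordered structure on a group, invariant under left multiplication, is given by
`[Group G] [Lattice G] [MulLeftMono G]`; the positive cone is `{x | 1 ≤ x}`, the order `≤` is the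
prefix order, and `⊓` is the gcd with respect to it. -/

namespace Garside

variable {G : Type*} [Group G] [Lattice G] [MulLeftMono G]

/-- `Δ` is a Garside element making the left-invariant lattice-ordered group `G` into a group with a
Garside structure of finite type. -/
structure IsGarsideElement (Δ : G) : Prop where
  one_le : 1 ≤ Δ
  /-- The simple elements generate the group. -/
  closure_simples : Subgroup.closure (Set.Icc 1 Δ) = ⊤
  /-- There are finitely many simple elements. -/
  finite_simples : (Set.Icc 1 Δ).Finite
  /-- Conjugation by `Δ` preserves the positive cone. -/
  conj_cone : (fun x : G => Δ⁻¹ * x * Δ) '' Set.Ici 1 = Set.Ici 1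
  /-- The positive cone is atomic: strict chains from `1` to `x` have bounded length. -/
  atomic : ∀ x : G, 1 ≤ x → ∃ N : ℕ, ∀ c : LTSeries G, c.head = 1 → c.last = x → c.length ≤ N

/-- `Δ ^ p * x₁ * ⋯ * xᵣ`, with `l = [x₁, …, xᵣ]`, is the left normal form of `X`. The factors are
required to be nontrivial, which is what makes the decomposition unique. -/
structure IsLeftNormalForm (Δ X : G) (p : ℤ) (l : List G) : Prop where
  eq_prod : X = Δ ^ p * l.prod
  one_le_prod : 1 ≤ l.prod
  not_le_prod : ¬ Δ ≤ l.prod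
  ne_one : ∀ x ∈ l, x ≠ 1
  /-- Each factor is the biggest simple prefix of the product of the factors from it onwards. -/
  factor : ∀ x t, (x :: t) <:+ l → x = (x :: t).prod ⊓ Δ

open Classical in
/-- The left normal form of `X`, as a pair `(p, [x₁, …, xᵣ])`. (When `Δ ≠ 1` is a Garside element,
every `X` has exactly one.) -/
noncomputable def leftNormalForm (Δ X : G) : ℤ × List G :=
  if h : ∃ q : ℤ × List G, IsLeftNormalForm Δ X q.1 q.2 then h.choose else (0, [])

/-- The infimum of `X`. -/
noncomputable def infimum (Δ X : G) : ℤ := (leftNormalForm Δ X).1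

/-- The canonical length of `X`. -/
noncomputable def canonicalLength (Δ X : G) : ℕ := (leftNormalForm Δ X).2.length

/-- The initial factor `ι(X) = τ⁻ᵖ(x₁)`, where `τ(x) = Δ⁻¹ x Δ`; it is `1` if `X` has canonical
length `0`. -/
noncomputable def initialFactor (Δ X : G) : G :=
  Δ ^ infimum Δ X * (leftNormalForm Δ X).2.headD 1 * (Δ ^ infimum Δ X)⁻¹

/-- Cycling: conjugation of `X` by its initial factor. -/
noncomputable def cycling (Δ X : G) : G :=
  (initialFactor Δ X)⁻¹ * X * initialFactor Δ X

/-- The super summit set: the conjugates of `X` of minimal canonical length. -/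
def superSummitSet (Δ X : G) : Set G :=
  {Y | IsConj X Y ∧ ∀ Z, IsConj X Z → canonicalLength Δ Y ≤ canonicalLength Δ Z}

/-- The ultra summit set: the elements of the super summit set that are periodic under cycling. -/
def ultraSummitSet (Δ X : G) : Set G :=
  {Y | Y ∈ superSummitSet Δ X ∧ ∃ m : ℕ, 0 < m ∧ (cycling Δ)^[m] Y = Y}

/-- `X = Δ ^ p * x₁ * ⋯ * xᵣ` (left normal form, `r > 0`) is rigid if
`Δ ^ p * x₁ * ⋯ * xᵣ * τ⁻ᵖ(x₁)` is in left normal form as written. -/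
def IsRigid (Δ X : G) : Prop :=
  ∃ (p : ℤ) (x : G) (t : List G), IsLeftNormalForm Δ X p (x :: t) ∧
    IsLeftNormalForm Δ (X * (Δ ^ p * x * (Δ ^ p)⁻¹)) p (x :: t ++ [Δ ^ p * x * (Δ ^ p)⁻¹])

/-- Some nonzero power of `X` is rigid. -/
def HasRigidPower (Δ X : G) : Prop := ∃ m : ℤ, m ≠ 0 ∧ IsRigid Δ (X ^ m)

end Garside

/-! Everything is phrased with meets instead of factor lists: the product of the first `k` factors
of a positive `g` is `g ⊓ Δ ^ k`.

Let `X` be in its ultra summit set with infimum `p`, and let `T_m` be the product of the first `m`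
conjugating elements of its cyclings. A priori `T_m` is the meet of all `X ^ i * Δ ^ (j - i * p)`
with `i + j = m`. Periodicity removes all but the extreme terms, so `T_m = X ^ m * Δ ^ (-m * p) ⊓ Δ
^ m` (`iterate_cyclingStep_eq`), and for a period `N` the element `T_N` commutes with `X` and
`T_{kN} = T_N ^ k`. If `Y = s⁻¹ * X * s` is also in the set, a pigeonhole argument gives a common
period at which `s` conjugates the cycling product of `X` to that of `Y`
(`exists_cyclingProduct_conj`).

Correct `X ^ N` and `T_N` by central powers of `Δ` to get `z` and `t` with `t ^ k = z ^ k ⊓ Δ ^ (k *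
n)` for all `k`. If `z` is rigid with blocks of length `n + j`, then `t ^ (n + j) = z ^ (n + j) ⊓ Δ
^ (n * (n + j)) = z ^ n`. This equation survives conjugation by `s`, so it holds for the `t` and `z`
of `Y`. There `t⁻¹ * z` and `t⁻¹ * Δ ^ n` have coprime powers. The equation identifies `(t⁻¹ * z) ^
n` with `t ^ j`, so `t ^ j` is coprime to its complement in `Δ ^ (j * n)`, which is rigidity
(`isPureRigid_pow_of_pow_eq`). Finally `(t ^ j) ^ (n + j) = z ^ (n * j)` is a power of `Y` up to a
central factor.

Canonical length greater than `1` ensures `j > 0`; `n > 0` follows from minimality of the length.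
Both rest on the fact that bounds on a power of `X` are realised by a conjugate of `X`
(`exists_conj_of_zpow_le_pow`). -/

namespace Garside

/-! ### Order properties of powers of `Δ`, finiteness of intervals, a central power. -/

section Basics

variable {G : Type*} [Group G] [Lattice G] [MulLeftMono G] {Δ : G}

theorem one_le_inv_mul_iff {a b : G} : 1 ≤ a⁻¹ * b ↔ a ≤ b := by
  rw [le_inv_mul_iff_mul_le, mul_one]

namespace IsGarsideElement

theorem one_le_conj_iff (hΔ : IsGarsideElement Δ) (x : G) : 1 ≤ Δ⁻¹ * x * Δ ↔ 1 ≤ x := by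
  constructor
  · intro h
    have h' : Δ⁻¹ * x * Δ ∈ (fun x : G => Δ⁻¹ * x * Δ) '' Set.Ici 1 := by
      rw [hΔ.conj_cone]; exact h
    obtain ⟨y, hy, hxy⟩ := h'
    have : y = x := by simpa using hxy
    exact this ▸ hy
  · intro h
    have h' : Δ⁻¹ * x * Δ ∈ (fun x : G => Δ⁻¹ * x * Δ) '' Set.Ici 1 := ⟨x, h, rfl⟩
    rw [hΔ.conj_cone] at h'
    exact h'

theorem one_le_conj_zpow_iff (hΔ : IsGarsideElement Δ) (x : G) (k : ℤ) :
    1 ≤ (Δ ^ k)⁻¹ * x * Δ ^ k ↔ 1 ≤ x := by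
  induction k with
  | zero => simp
  | succ k ih =>
    rw [← ih, ← hΔ.one_le_conj_iff ((Δ ^ (k : ℤ))⁻¹ * x * Δ ^ (k : ℤ))]
    simp only [zpow_add_one, mul_inv_rev, mul_assoc]
  | pred k ih =>
    rw [← ih, ← hΔ.one_le_conj_iff]
    simp only [zpow_sub_one, mul_inv_rev, mul_assoc, inv_inv, inv_mul_cancel_left, inv_mul_cancel,
      mul_one]

theorem mul_zpow_le_mul_zpow_iff (hΔ : IsGarsideElement Δ) {a b : G} (k : ℤ) :
    a * Δ ^ k ≤ b * Δ ^ k ↔ a ≤ b := by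
  rw [← one_le_inv_mul_iff, ← one_le_inv_mul_iff (a := a), ← hΔ.one_le_conj_zpow_iff (a⁻¹ * b) k]
  simp only [mul_inv_rev, mul_assoc]

theorem mul_zpow_le_iff (hΔ : IsGarsideElement Δ) {a b : G} (k : ℤ) :
    a * Δ ^ k ≤ b ↔ a ≤ b * Δ ^ (-k) := by
  rw [← hΔ.mul_zpow_le_mul_zpow_iff (-k), mul_assoc, ← zpow_add, add_neg_cancel, zpow_zero, mul_one]

theorem le_mul_zpow_iff (hΔ : IsGarsideElement Δ) {a b : G} (k : ℤ) :
    a ≤ b * Δ ^ k ↔ a * Δ ^ (-k) ≤ b := by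
  rw [hΔ.mul_zpow_le_iff, neg_neg]

theorem inf_mul_zpow (hΔ : IsGarsideElement Δ) (a b : G) (k : ℤ) :
    (a ⊓ b) * Δ ^ k = a * Δ ^ k ⊓ b * Δ ^ k := by
  apply eq_of_forall_le_iff
  intro c
  rw [hΔ.le_mul_zpow_iff, le_inf_iff, le_inf_iff, hΔ.le_mul_zpow_iff, hΔ.le_mul_zpow_iff]

theorem one_le_zpow (hΔ : IsGarsideElement Δ) {k : ℤ} (hk : 0 ≤ k) : 1 ≤ Δ ^ k := by
  obtain ⟨n, rfl⟩ := Int.eq_ofNat_of_zero_le hk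
  simpa using one_le_pow_of_one_le' hΔ.one_le n

theorem zpow_le_zpow (hΔ : IsGarsideElement Δ) {j k : ℤ} (h : j ≤ k) : Δ ^ j ≤ Δ ^ k := by
  rw [← one_le_inv_mul_iff, ← zpow_neg, ← zpow_add]
  exact hΔ.one_le_zpow (by omega)

theorem zpow_le_inv_iff (hΔ : IsGarsideElement Δ) {x : G} (k : ℤ) :
    Δ ^ (-k) ≤ x⁻¹ ↔ x ≤ Δ ^ k := by
  rw [← one_le_inv_mul_iff, ← one_le_inv_mul_iff (a := x), ← hΔ.one_le_conj_zpow_iff (x⁻¹ * Δ ^ k) (-k)]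
  simp [mul_assoc]

theorem inv_le_zpow_iff (hΔ : IsGarsideElement Δ) {x : G} (k : ℤ) :
    x⁻¹ ≤ Δ ^ (-k) ↔ Δ ^ k ≤ x := by
  rw [← hΔ.zpow_le_inv_iff, neg_neg, inv_inv]

theorem zpow_add_le_mul (hΔ : IsGarsideElement Δ) {x y : G} {j k : ℤ} (hx : Δ ^ j ≤ x)
    (hy : Δ ^ k ≤ y) : Δ ^ (j + k) ≤ x * y := by
  calc Δ ^ (j + k) = Δ ^ j * Δ ^ k := zpow_add ..
    _ ≤ x * Δ ^ k := (hΔ.mul_zpow_le_mul_zpow_iff k).2 hx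
    _ ≤ x * y := by gcongr

theorem mul_le_zpow_add (hΔ : IsGarsideElement Δ) {x y : G} {j k : ℤ} (hx : x ≤ Δ ^ j)
    (hy : y ≤ Δ ^ k) : x * y ≤ Δ ^ (j + k) := by
  calc x * y ≤ x * Δ ^ k := by gcongr
    _ ≤ Δ ^ j * Δ ^ k := (hΔ.mul_zpow_le_mul_zpow_iff k).2 hx
    _ = Δ ^ (j + k) := (zpow_add ..).symm

theorem exists_zpow_bounds (hΔ : IsGarsideElement Δ) (g : G) :
    ∃ K : ℕ, Δ ^ (-K : ℤ) ≤ g ∧ g ≤ Δ ^ (K : ℤ) := by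
  have hg : g ∈ Subgroup.closure (Set.Icc 1 Δ) := by simp [hΔ.closure_simples]
  induction hg using Subgroup.closure_induction with
  | mem x hx =>
    refine ⟨1, le_trans ?_ hx.1, by simpa using hx.2⟩
    simpa using hΔ.zpow_le_zpow (show (-1 : ℤ) ≤ 0 by norm_num)
  | one => exact ⟨0, by simp⟩
  | mul x y _ _ hx hy =>
    obtain ⟨K, h1, h2⟩ := hx
    obtain ⟨L, h3, h4⟩ := hy
    refine ⟨K + L, ?_, ?_⟩
    · have := hΔ.zpow_add_le_mul h1 h3
      rwa [← neg_add] at this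
    · exact_mod_cast hΔ.mul_le_zpow_add h2 h4
  | inv x _ hx =>
    obtain ⟨K, h1, h2⟩ := hx
    exact ⟨K, (hΔ.zpow_le_inv_iff _).2 h2, by simpa using (hΔ.inv_le_zpow_iff (-K : ℤ)).2 h1⟩

/-- If `g ≤ Δ ^ (k + 1)` then removing the greatest simple prefix leaves a prefix of `Δ ^ k`. -/
theorem inv_inf_mul_le (hΔ : IsGarsideElement Δ) {g : G} {k : ℤ} (hk : 0 ≤ k)
    (h : g ≤ Δ ^ (k + 1)) : (g ⊓ Δ)⁻¹ * g ≤ Δ ^ k := by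
  rw [inv_mul_le_iff_le_mul, hΔ.inf_mul_zpow, ← zpow_one_add, add_comm 1 k, le_inf_iff]
  refine ⟨?_, h⟩
  calc g = g * 1 := (mul_one g).symm
    _ ≤ g * Δ ^ k := by gcongr; exact hΔ.one_le_zpow hk

theorem finite_Icc_one_zpow (hΔ : IsGarsideElement Δ) (n : ℕ) :
    (Set.Icc 1 (Δ ^ (n : ℤ))).Finite := by
  induction n with
  | zero => simp
  | succ n ih =>
    refine (hΔ.finite_simples.mul ih).subset ?_
    rintro g ⟨h1, h2⟩
    refine ⟨g ⊓ Δ, ⟨le_inf h1 hΔ.one_le, inf_le_right⟩, (g ⊓ Δ)⁻¹ * g, ⟨?_, ?_⟩, by simp⟩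
    · rw [one_le_inv_mul_iff]; exact inf_le_left
    · exact hΔ.inv_inf_mul_le (by omega) (by exact_mod_cast h2)

theorem finite_Icc (hΔ : IsGarsideElement Δ) (a b : G) : (Set.Icc a b).Finite := by
  obtain ⟨K, hK, -⟩ := hΔ.exists_zpow_bounds (a⁻¹ * b)
  obtain ⟨K, -, hK⟩ := hΔ.exists_zpow_bounds (a⁻¹ * b)
  refine ((hΔ.finite_Icc_one_zpow K).image (a * ·)).subset ?_
  rintro g ⟨h1, h2⟩
  refine ⟨a⁻¹ * g, ⟨one_le_inv_mul_iff.2 h1, le_trans ?_ hK⟩, by simp⟩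
  gcongr

/-- Conjugation by `Δ` permutes the finitely many simple elements, which generate; the product of
their periods serves as exponent. -/
theorem exists_zpow_central (hΔ : IsGarsideElement Δ) :
    ∃ e : ℕ, 0 < e ∧ ∀ g, Commute (Δ ^ (e : ℤ)) g := by
  have key : ∀ s ∈ Set.Icc 1 Δ, ∃ e : ℕ, 0 < e ∧ Commute (Δ ^ e) s := by
    rintro s ⟨h1, h2⟩
    have hmem : ∀ k : ℕ, (Δ ^ (k : ℤ))⁻¹ * s * Δ ^ (k : ℤ) ∈ Set.Icc 1 Δ := by
      intro k
      refine ⟨(hΔ.one_le_conj_zpow_iff s k).2 h1, ?_⟩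
      rw [hΔ.mul_zpow_le_iff, inv_mul_le_iff_le_mul, ← zpow_one_add, ← zpow_add]
      simpa using h2
    obtain ⟨i, j, hij, h⟩ := hΔ.finite_simples.exists_lt_map_eq_of_forall_mem hmem
    refine ⟨j - i, by omega, ?_⟩
    have hj : Δ ^ (j : ℤ) = Δ ^ (j - i) * Δ ^ (i : ℤ) := by
      rw [zpow_natCast, zpow_natCast, ← pow_add]; congr 1; omega
    rw [hj, show (Δ ^ (j - i) * Δ ^ (i : ℤ))⁻¹ * s * (Δ ^ (j - i) * Δ ^ (i : ℤ)) =
      (Δ ^ (i : ℤ))⁻¹ * ((Δ ^ (j - i))⁻¹ * s * Δ ^ (j - i)) * Δ ^ (i : ℤ) by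
        simp only [mul_inv_rev, mul_assoc]] at h
    have h' : s = (Δ ^ (j - i))⁻¹ * s * Δ ^ (j - i) := mul_left_cancel (mul_right_cancel h)
    rw [mul_assoc, eq_inv_mul_iff_mul_eq] at h'
    exact h'
  choose! f hf using key
  refine ⟨∏ s ∈ hΔ.finite_simples.toFinset, f s, Finset.prod_pos fun s hs => (hf s ?_).1, ?_⟩
  · simpa using hs
  intro g
  have hg : g ∈ Subgroup.closure (Set.Icc 1 Δ) := by simp [hΔ.closure_simples]
  rw [zpow_natCast]
  induction hg using Subgroup.closure_induction with
  | mem x hx =>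
    obtain ⟨k, hk⟩ := Finset.dvd_prod_of_mem f (hΔ.finite_simples.mem_toFinset.2 hx)
    rw [hk, pow_mul]
    exact (hf x hx).2.pow_left k
  | one => exact Commute.one_right _
  | mul x y _ _ hx hy => exact hx.mul_right hy
  | inv x _ hx => exact hx.inv_right

end IsGarsideElement

end Basics

end Garside
namespace Garside

/-! ### Greedy decompositions and the order-theoretic form of infimum, length and initial factor. -/

section NormalForm

variable {G : Type*} [Group G] [Lattice G] {Δ : G}

/-- Each entry of the list is the greatest simple prefix of the product from it onwards. -/
def IsGreedy (Δ : G) (l : List G) : Prop :=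
  ∀ x t, (x :: t) <:+ l → x = (x :: t).prod ⊓ Δ

theorem isGreedy_cons_iff {x : G} {t : List G} :
    IsGreedy Δ (x :: t) ↔ x = (x * t.prod) ⊓ Δ ∧ IsGreedy Δ t := by
  constructor
  · intro h
    exact ⟨by simpa using h x t (List.suffix_refl _),
      fun y u hu => h y u (hu.trans (List.suffix_cons x t))⟩
  · rintro ⟨h1, h2⟩ y u hu
    rcases List.suffix_cons_iff.1 hu with h | h
    · obtain ⟨rfl, rfl⟩ := List.cons.inj h
      simpa using h1
    · exact h2 y u h

variable [MulLeftMono G]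

theorem IsGreedy.one_le_prod_of_cons {x : G} {t : List G} (h : IsGreedy Δ (x :: t)) :
    1 ≤ t.prod := by
  have h1 : x ≤ x * t.prod := by
    conv_lhs => rw [(isGreedy_cons_iff.1 h).1]
    exact inf_le_left
  exact (le_mul_iff_one_le_right' x).1 h1

theorem IsGreedy.prod_le (hΔ : IsGarsideElement Δ) {l : List G} (h : IsGreedy Δ l) :
    l.prod ≤ Δ ^ (l.length : ℤ) := by
  induction l with
  | nil => simp
  | cons x t ih =>
    obtain ⟨h1, h2⟩ := isGreedy_cons_iff.1 h
    have hx : x ≤ Δ ^ (1 : ℤ) := by rw [h1, zpow_one]; exact inf_le_right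
    have := hΔ.mul_le_zpow_add hx (ih h2)
    rw [List.prod_cons, List.length_cons, Nat.cast_succ, add_comm]
    exact this

theorem IsGreedy.length_le (hΔ : IsGarsideElement Δ) {l : List G} (h : IsGreedy Δ l)
    (h1 : 1 ≤ l.prod) (hne : ∀ x ∈ l, x ≠ 1) {m : ℕ} (hm : l.prod ≤ Δ ^ (m : ℤ)) :
    l.length ≤ m := by
  induction l generalizing m with
  | nil => simp
  | cons x t ih =>
    obtain ⟨hx, ht⟩ := isGreedy_cons_iff.1 h
    rw [List.prod_cons] at h1 hm
    cases m with
    | zero =>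
      have e : x * t.prod = 1 := le_antisymm (by simpa using hm) h1
      rw [e, inf_eq_left.2 hΔ.one_le] at hx
      exact absurd hx (hne x (by simp))
    | succ m =>
      have := hΔ.inv_inf_mul_le (k := m) (by omega) (by exact_mod_cast hm)
      rw [← hx, inv_mul_cancel_left] at this
      have := ih ht h.one_le_prod_of_cons (fun y hy => hne y (by simp [hy])) this
      simpa using this

namespace IsGarsideElement

/-- Distributing the product yields a third term `g * Δ ^ b`, which `g` absorbs. This lets initial
segments be computed block by block. -/
theorem inf_zpow_add (hΔ : IsGarsideElement Δ) (g : G) (a : ℤ) {b : ℤ} (hb : 0 ≤ b) :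
    g ⊓ Δ ^ (a + b) = (g ⊓ Δ ^ a) * (((g ⊓ Δ ^ a)⁻¹ * g) ⊓ Δ ^ b) := by
  have h : g ≤ g * Δ ^ b := (le_mul_iff_one_le_right' g).2 (hΔ.one_le_zpow hb)
  rw [mul_inf, mul_inv_cancel_left, hΔ.inf_mul_zpow, ← zpow_add, ← inf_assoc, inf_eq_left.2 h]

theorem eq_one_of_inf_eq_one (hΔ : IsGarsideElement Δ) {g : G} {m : ℕ} (h1 : 1 ≤ g)
    (hm : g ≤ Δ ^ (m : ℤ)) (h : g ⊓ Δ = 1) : g = 1 := by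
  induction m with
  | zero => exact le_antisymm (by simpa using hm) h1
  | succ m ih =>
    have := hΔ.inv_inf_mul_le (k := m) (by omega) (by exact_mod_cast hm)
    rw [h] at this
    exact ih (by simpa using this)

theorem exists_isGreedy (hΔ : IsGarsideElement Δ) {m : ℕ} {g : G} (h1 : 1 ≤ g)
    (hm : g ≤ Δ ^ (m : ℤ)) :
    ∃ l : List G, l.prod = g ∧ l.length ≤ m ∧ (∀ x ∈ l, x ≠ 1) ∧ IsGreedy Δ l := by
  induction m generalizing g with
  | zero =>
    refine ⟨[], (le_antisymm (by simpa using hm) h1).symm, by simp, by simp, ?_⟩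
    intro x t h
    simp at h
  | succ m ih =>
    by_cases hg : g = 1
    · refine ⟨[], hg.symm, by simp, by simp, ?_⟩
      intro x t h
      simp at h
    obtain ⟨t, ht, hlen, hne, hgr⟩ := ih (g := (g ⊓ Δ)⁻¹ * g)
      (one_le_inv_mul_iff.2 inf_le_left)
      (hΔ.inv_inf_mul_le (k := m) (by omega) (by exact_mod_cast hm))
    refine ⟨(g ⊓ Δ) :: t, by simp [ht], by simpa using hlen, ?_, ?_⟩
    · intro x hx
      rcases List.mem_cons.1 hx with rfl | hx
      · exact fun h => hg (hΔ.eq_one_of_inf_eq_one h1 hm h)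
      · exact hne x hx
    · exact isGreedy_cons_iff.2 ⟨by simp [ht], hgr⟩

end IsGarsideElement

theorem IsGreedy.append_prod_inf (hΔ : IsGarsideElement Δ) {l₁ l₂ : List G}
    (h : IsGreedy Δ (l₁ ++ l₂)) (h1 : 1 ≤ (l₁ ++ l₂).prod) :
    (l₁ ++ l₂).prod ⊓ Δ ^ (l₁.length : ℤ) = l₁.prod := by
  induction l₁ with
  | nil => simpa using h1
  | cons x t ih =>
    rw [List.cons_append] at h h1 ⊢
    obtain ⟨hx, ht⟩ := isGreedy_cons_iff.1 h
    rw [List.length_cons, Nat.cast_succ, add_comm (t.length : ℤ) 1,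
      hΔ.inf_zpow_add _ _ (by omega), List.prod_cons, zpow_one, ← hx, inv_mul_cancel_left,
      ih ht h.one_le_prod_of_cons, List.prod_cons]

namespace IsGarsideElement

theorem zpow_le_zpow_iff (hΔ : IsGarsideElement Δ) (hne : Δ ≠ 1) {j k : ℤ} :
    Δ ^ j ≤ Δ ^ k ↔ j ≤ k := by
  refine ⟨fun h => ?_, hΔ.zpow_le_zpow⟩
  by_contra! hlt
  have h2 : Δ ^ (k + 1) ≤ Δ ^ k := (hΔ.zpow_le_zpow (by omega)).trans h
  rw [zpow_add_one, mul_le_iff_le_one_right'] at h2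
  exact hne (le_antisymm h2 hΔ.one_le)

theorem exists_isLeftNormalForm (hΔ : IsGarsideElement Δ) (hne : Δ ≠ 1) (X : G) :
    ∃ q : ℤ × List G, IsLeftNormalForm Δ X q.1 q.2 := by
  obtain ⟨K, h1, h2⟩ := hΔ.exists_zpow_bounds X
  obtain ⟨p, hp, hmax⟩ := Int.exists_greatest_of_bdd (P := fun z => Δ ^ z ≤ X)
    ⟨K, fun z hz => (hΔ.zpow_le_zpow_iff hne).1 (hz.trans h2)⟩ ⟨-K, h1⟩
  have hpK : p ≤ K := (hΔ.zpow_le_zpow_iff hne).1 (hp.trans h2)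
  obtain ⟨m, hm⟩ := Int.eq_ofNat_of_zero_le (a := (K : ℤ) - p) (by omega)
  obtain ⟨l, hl, -, hl1, hl2⟩ := hΔ.exists_isGreedy (m := m) (g := (Δ ^ p)⁻¹ * X)
    (one_le_inv_mul_iff.2 hp) (by
      rw [inv_mul_le_iff_le_mul, ← zpow_add, show p + (m : ℤ) = K by omega]; exact h2)
  refine ⟨(p, l), by simp [hl], by rw [hl]; exact one_le_inv_mul_iff.2 hp, ?_, hl1, hl2⟩
  rw [hl, le_inv_mul_iff_mul_le, ← zpow_add_one]
  intro h
  have := hmax _ h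
  omega

theorem isLeftNormalForm_leftNormalForm (hΔ : IsGarsideElement Δ) (hne : Δ ≠ 1) (X : G) :
    IsLeftNormalForm Δ X (infimum Δ X) (leftNormalForm Δ X).2 := by
  have h := hΔ.exists_isLeftNormalForm hne X
  rw [infimum, leftNormalForm, dif_pos h]
  exact h.choose_spec

theorem zpow_infimum_le (hΔ : IsGarsideElement Δ) (hne : Δ ≠ 1) (X : G) :
    Δ ^ infimum Δ X ≤ X := by
  have h := hΔ.isLeftNormalForm_leftNormalForm hne X
  conv_rhs => rw [h.eq_prod]
  exact (le_mul_iff_one_le_right' _).2 h.one_le_prod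

/-- Together with `zpow_infimum_le` this determines the infimum from the order alone, whichever
normal form was chosen. -/
theorem le_infimum (hΔ : IsGarsideElement Δ) (hne : Δ ≠ 1) {X : G} {q : ℤ} (hq : Δ ^ q ≤ X) :
    q ≤ infimum Δ X := by
  have h := hΔ.isLeftNormalForm_leftNormalForm hne X
  by_contra! hlt
  have h2 : Δ ^ (infimum Δ X + 1) ≤ X := (hΔ.zpow_le_zpow (by omega)).trans hq
  conv_rhs at h2 => rw [h.eq_prod]
  rw [zpow_add_one, mul_le_mul_iff_left] at h2
  exact h.not_le_prod h2

theorem le_zpow_infimum_add (hΔ : IsGarsideElement Δ) (hne : Δ ≠ 1) (X : G) :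
    X ≤ Δ ^ (infimum Δ X + canonicalLength Δ X) := by
  have h := hΔ.isLeftNormalForm_leftNormalForm hne X
  conv_lhs => rw [h.eq_prod]
  rw [zpow_add, mul_le_mul_iff_left]
  exact IsGreedy.prod_le hΔ h.factor

theorem canonicalLength_le (hΔ : IsGarsideElement Δ) (hne : Δ ≠ 1) {X : G} {b : ℤ}
    (hb : X ≤ Δ ^ b) : infimum Δ X + canonicalLength Δ X ≤ b := by
  have h := hΔ.isLeftNormalForm_leftNormalForm hne X
  have h1 : infimum Δ X ≤ b := (hΔ.zpow_le_zpow_iff hne).1 ((hΔ.zpow_infimum_le hne X).trans hb)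
  obtain ⟨m, hm⟩ := Int.eq_ofNat_of_zero_le (a := b - infimum Δ X) (by omega)
  rw [h.eq_prod, show b = infimum Δ X + (m : ℤ) by omega, zpow_add,
    mul_le_mul_iff_left] at hb
  have := IsGreedy.length_le hΔ h.factor h.one_le_prod h.ne_one hb
  simp only [canonicalLength]
  omega

theorem initialFactor_eq (hΔ : IsGarsideElement Δ) (hne : Δ ≠ 1) (X : G) :
    initialFactor Δ X = X * Δ ^ (-infimum Δ X) ⊓ Δ := by
  have h := hΔ.isLeftNormalForm_leftNormalForm hne X
  have hhead : (leftNormalForm Δ X).2.headD 1 = (leftNormalForm Δ X).2.prod ⊓ Δ := by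
    have hg := h.factor
    cases hl : (leftNormalForm Δ X).2 with
    | nil => simpa using hΔ.one_le
    | cons x t =>
      rw [hl] at hg
      exact hg x t (List.suffix_refl _)
  rw [initialFactor, hhead, mul_inf, ← zpow_neg, hΔ.inf_mul_zpow, ← h.eq_prod]
  congr 1
  rw [← zpow_add_one, ← zpow_add]
  simp

end IsGarsideElement

end NormalForm

end Garside
namespace Garside

/-! ### Improving infimum and supremum by conjugation. -/

section Summit

variable {G : Type*} [Group G] [Lattice G] [MulLeftMono G] {Δ : G}

/-- The iterates of this map at `1` are the meets of the elements `X ^ i * Δ ^ (-i * q)`. -/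
def infStep (Δ X : G) (q : ℤ) (u : G) : G := 1 ⊓ X * u * Δ ^ (-q)

namespace IsGarsideElement

theorem infStep_mono (hΔ : IsGarsideElement Δ) (X : G) (q : ℤ) : Monotone (infStep Δ X q) := by
  intro u v h
  refine inf_le_inf_left _ ((hΔ.mul_zpow_le_mul_zpow_iff _).2 ?_)
  gcongr

theorem antitone_iterate_infStep (hΔ : IsGarsideElement Δ) (X : G) (q : ℤ) :
    Antitone fun k => (infStep Δ X q)^[k] 1 :=
  (hΔ.infStep_mono X q).antitone_iterate_of_map_le inf_le_left

theorem le_iterate_infStep_iff (hΔ : IsGarsideElement Δ) (X : G) (q : ℤ) (k : ℕ) (g : G) :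
    g ≤ (infStep Δ X q)^[k] 1 ↔ ∀ i ≤ k, g ≤ X ^ i * Δ ^ (-(i * q)) := by
  induction k generalizing g with
  | zero => simp
  | succ k ih =>
    rw [Function.iterate_succ_apply', infStep, le_inf_iff, hΔ.le_mul_zpow_iff,
      ← inv_mul_le_iff_le_mul, ih]
    have key : ∀ i : ℕ, X⁻¹ * (g * Δ ^ (- -q)) ≤ X ^ i * Δ ^ (-(i * q)) ↔
        g ≤ X ^ (i + 1) * Δ ^ (-((i + 1 : ℕ) * q)) := by
      intro i
      rw [inv_mul_le_iff_le_mul, hΔ.mul_zpow_le_iff, ← mul_assoc, ← pow_succ', mul_assoc, ← zpow_add]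
      congr! 3
      push_cast
      ring
    constructor
    · rintro ⟨h1, h2⟩ i hi
      cases i with
      | zero => simpa using h1
      | succ i => exact (key i).1 (h2 i (by omega))
    · intro h
      exact ⟨by simpa using h 0 (by omega), fun i hi => (key i).2 (h (i + 1) (by omega))⟩

/-- A stable iterate `u` satisfies `u ≤ X * u * Δ ^ (-q)`, which is the lower bound. The upper
bound, `X * u * Δ ^ (-b) ≤ u`, holds for every iterate by induction. -/
theorem exists_conj_of_iterate_infStep_le (hΔ : IsGarsideElement Δ) {X : G} {q b : ℤ}
    (hb : X ≤ Δ ^ b) {k : ℕ} (hk : (infStep Δ X q)^[k] 1 ≤ (infStep Δ X q)^[k + 1] 1) :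
    ∃ u, Δ ^ q ≤ u⁻¹ * X * u ∧ u⁻¹ * X * u ≤ Δ ^ b := by
  refine ⟨(infStep Δ X q)^[k] 1, ?_, ?_⟩
  · rw [Function.iterate_succ_apply'] at hk
    have := hk.trans inf_le_right
    rwa [hΔ.le_mul_zpow_iff, neg_neg, ← le_inv_mul_iff_mul_le, ← mul_assoc] at this
  · rw [mul_assoc, inv_mul_le_iff_le_mul, hΔ.le_mul_zpow_iff]
    clear hk
    have h1 : X * Δ ^ (-b) ≤ 1 := by rwa [hΔ.mul_zpow_le_iff, neg_neg, one_mul]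
    induction k with
    | zero => simpa using h1
    | succ k ih =>
      conv_rhs => rw [Function.iterate_succ_apply', infStep]
      rw [le_inf_iff]
      constructor
      · refine le_trans ((hΔ.mul_zpow_le_mul_zpow_iff _).2 ?_) h1
        rw [mul_le_iff_le_one_right', Function.iterate_succ_apply']
        exact inf_le_left
      · calc X * (infStep Δ X q)^[k + 1] 1 * Δ ^ (-b)
            ≤ X * (X * (infStep Δ X q)^[k] 1 * Δ ^ (-q)) * Δ ^ (-b) := by
              rw [hΔ.mul_zpow_le_mul_zpow_iff, mul_le_mul_iff_left, Function.iterate_succ_apply']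
              exact inf_le_right
          _ = X * (X * (infStep Δ X q)^[k] 1 * Δ ^ (-b)) * Δ ^ (-q) := by
              simp only [mul_assoc, ← zpow_add, add_comm]
          _ ≤ _ := by
              rw [hΔ.mul_zpow_le_mul_zpow_iff, mul_le_mul_iff_left]
              exact ih

/-- The infimum of `X` can be raised by conjugation without raising its supremum. -/
theorem exists_conj_of_zpow_le_conj (hΔ : IsGarsideElement Δ) {X s : G} {q b : ℤ}
    (hb : X ≤ Δ ^ b) (hs : Δ ^ q ≤ s⁻¹ * X * s) :
    ∃ u, Δ ^ q ≤ u⁻¹ * X * u ∧ u⁻¹ * X * u ≤ Δ ^ b := by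
  obtain ⟨K, -, hK⟩ := hΔ.exists_zpow_bounds s
  have h1 : s * Δ ^ (-K : ℤ) ≤ 1 := by rwa [hΔ.mul_zpow_le_iff, neg_neg, one_mul]
  have h2 : s * Δ ^ (-K : ℤ) ≤ X * (s * Δ ^ (-K : ℤ)) * Δ ^ (-q) := by
    rw [mul_assoc, le_inv_mul_iff_mul_le] at hs
    rw [hΔ.le_mul_zpow_iff, neg_neg, mul_assoc, ← zpow_add, add_comm, zpow_add, ← mul_assoc,
      ← mul_assoc, hΔ.mul_zpow_le_mul_zpow_iff]
    exact hs
  -- By `h2` the element `s * Δ ^ (-K)` stays below every iterate, so the descending sequence lives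
  -- in a finite interval and stabilises.
  have hmem : ∀ k, (infStep Δ X q)^[k] 1 ∈ Set.Icc (s * Δ ^ (-K : ℤ)) 1 := by
    intro k
    refine ⟨?_, hΔ.antitone_iterate_infStep X q (Nat.zero_le k)⟩
    induction k with
    | zero => exact h1
    | succ k ih =>
      rw [Function.iterate_succ_apply']
      refine le_inf h1 (h2.trans ((hΔ.mul_zpow_le_mul_zpow_iff _).2 ?_))
      gcongr
  obtain ⟨i, j, hij, h⟩ := (hΔ.finite_Icc _ _).exists_lt_map_eq_of_forall_mem hmem
  refine hΔ.exists_conj_of_iterate_infStep_le hb (k := i) ?_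
  rw [h]
  exact hΔ.antitone_iterate_infStep X q (show i + 1 ≤ j from hij)

/-- The term `X ^ M * Δ ^ (-M * q)` is at least `1`, the term of index `0`, so it adds nothing to
the meet and the iterates stabilise at `M - 1`. -/
theorem exists_conj_of_zpow_le_pow (hΔ : IsGarsideElement Δ) {X : G} {q b : ℤ} {M : ℕ}
    (hM : 0 < M) (hb : X ≤ Δ ^ b) (hX : Δ ^ (M * q) ≤ X ^ M) :
    ∃ u, Δ ^ q ≤ u⁻¹ * X * u ∧ u⁻¹ * X * u ≤ Δ ^ b := by
  obtain ⟨k, rfl⟩ := Nat.exists_eq_succ_of_ne_zero hM.ne'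
  refine hΔ.exists_conj_of_iterate_infStep_le hb (k := k) ?_
  rw [hΔ.le_iterate_infStep_iff]
  intro i hi
  rcases Nat.lt_succ_iff_lt_or_eq.1 (Nat.lt_succ_of_le hi) with h | rfl
  · exact (hΔ.le_iterate_infStep_iff X q k _).1 le_rfl i (by omega)
  · refine (hΔ.antitone_iterate_infStep X q (Nat.zero_le k)).trans ?_
    rw [hΔ.le_mul_zpow_iff, neg_neg]
    simpa using hX

theorem exists_conj_of_pow_le_zpow (hΔ : IsGarsideElement Δ) {X : G} {p b : ℤ} {M : ℕ}
    (hM : 0 < M) (hp : Δ ^ p ≤ X) (hX : X ^ M ≤ Δ ^ (M * b)) :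
    ∃ u, Δ ^ p ≤ u⁻¹ * X * u ∧ u⁻¹ * X * u ≤ Δ ^ b := by
  obtain ⟨u, h1, h2⟩ := hΔ.exists_conj_of_zpow_le_pow (X := X⁻¹) (q := -b) (b := -p) hM
    ((hΔ.inv_le_zpow_iff _).2 hp) (by rw [inv_pow, mul_neg]; exact (hΔ.zpow_le_inv_iff _).2 hX)
  have e : u⁻¹ * X⁻¹ * u = (u⁻¹ * X * u)⁻¹ := by group
  rw [e] at h1 h2
  exact ⟨u, (hΔ.inv_le_zpow_iff _).1 h2, (hΔ.zpow_le_inv_iff _).1 h1⟩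

end IsGarsideElement

end Summit

/-! ### Iterated cycling as a meet. -/

section Cycling

variable {G : Type*} [Group G] [Lattice G] [MulLeftMono G] {Δ : G}

/-- For `X` of infimum `p`, the `k`-th iterate of this map at `1` conjugates `X` to its `k`-th
cycling, as long as the cyclings of `X` have infimum `p` too. -/
def cyclingStep (Δ X : G) (p : ℤ) (u : G) : G := X * u * Δ ^ (-p) ⊓ u * Δ

theorem cyclingStep_mul {X g : G} (h : Commute X g) (p : ℤ) (u : G) :
    cyclingStep Δ X p (g * u) = g * cyclingStep Δ X p u := by
  rw [cyclingStep, cyclingStep, mul_inf, ← mul_assoc X, h.eq]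
  simp only [mul_assoc]

theorem iterate_cyclingStep_mul {X g : G} (h : Commute X g) (p : ℤ) (u : G) (k : ℕ) :
    (cyclingStep Δ X p)^[k] (g * u) = g * (cyclingStep Δ X p)^[k] u := by
  induction k with
  | zero => rfl
  | succ k ih => rw [Function.iterate_succ_apply', Function.iterate_succ_apply', ih,
      cyclingStep_mul h]

theorem iterate_cyclingStep_period {X : G} {p : ℤ} {N : ℕ}
    (h : Commute X ((cyclingStep Δ X p)^[N] 1)) (k m : ℕ) :
    (cyclingStep Δ X p)^[k * N + m] 1 =
      ((cyclingStep Δ X p)^[N] 1) ^ k * (cyclingStep Δ X p)^[m] 1 := by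
  induction k with
  | zero => simp
  | succ k ih =>
    rw [show (k + 1) * N + m = (k * N + m) + N by ring, Function.iterate_add_apply]
    nth_rewrite 1 [← mul_one ((cyclingStep Δ X p)^[N] 1)]
    rw [iterate_cyclingStep_mul h, ih, pow_succ', mul_assoc]

namespace IsGarsideElement

/-- The maps `u ↦ X * u * Δ ^ (-p)` and `u ↦ u * Δ` commute and preserve meets, so the `k`-th
iterate is the meet over all ways of applying one `i` times and the other `j` times. -/
theorem le_iterate_cyclingStep_iff (hΔ : IsGarsideElement Δ) (X : G) (p : ℤ) (k : ℕ) (g u : G) :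
    g ≤ (cyclingStep Δ X p)^[k] u ↔
      ∀ i j : ℕ, i + j = k → g ≤ X ^ i * u * Δ ^ ((j : ℤ) - i * p) := by
  induction k generalizing g with
  | zero =>
    constructor
    · intro h i j hij
      obtain ⟨rfl, rfl⟩ : i = 0 ∧ j = 0 := by omega
      simpa using h
    · intro h
      simpa using h 0 0 rfl
  | succ k ih =>
    rw [Function.iterate_succ_apply', cyclingStep, le_inf_iff, hΔ.le_mul_zpow_iff,
      ← inv_mul_le_iff_le_mul, ih]
    have h1 : g ≤ (cyclingStep Δ X p)^[k] u * Δ ↔ g * Δ ^ (-1 : ℤ) ≤ (cyclingStep Δ X p)^[k] u := by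
      rw [← hΔ.le_mul_zpow_iff, zpow_one]
    rw [h1, ih]
    have e1 : ∀ i j : ℕ, X⁻¹ * (g * Δ ^ (- -p)) ≤ X ^ i * u * Δ ^ ((j : ℤ) - i * p) ↔
        g ≤ X ^ (i + 1) * u * Δ ^ ((j : ℤ) - (i + 1 : ℕ) * p) := by
      intro i j
      rw [inv_mul_le_iff_le_mul, hΔ.mul_zpow_le_iff, ← mul_assoc, ← mul_assoc, ← pow_succ',
        mul_assoc (_ * u), ← zpow_add]
      congr! 3
      push_cast
      ring
    have e2 : ∀ i j : ℕ, g * Δ ^ (-1 : ℤ) ≤ X ^ i * u * Δ ^ ((j : ℤ) - i * p) ↔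
        g ≤ X ^ i * u * Δ ^ (((j + 1 : ℕ) : ℤ) - i * p) := by
      intro i j
      rw [hΔ.mul_zpow_le_iff, mul_assoc (_ * u), ← zpow_add]
      congr! 3
      push_cast
      ring
    simp only [e1, e2]
    constructor
    · rintro ⟨h2, h3⟩ i j hij
      cases i with
      | zero =>
        obtain rfl : j = k + 1 := by omega
        exact h3 0 k (by omega)
      | succ i => exact h2 i j (by omega)
    · intro h
      exact ⟨fun i j hij => h (i + 1) j (by omega), fun i j hij => h i (j + 1) (by omega)⟩

/-- If the iterates of `cyclingStep` at `1` become periodic, only the two extreme terms of the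
meets that they are matter. -/
theorem iterate_cyclingStep_eq (hΔ : IsGarsideElement Δ) {X : G} {p : ℤ} {N : ℕ} (hN : 0 < N)
    (h : Commute X ((cyclingStep Δ X p)^[N] 1)) (m : ℕ) :
    (cyclingStep Δ X p)^[m] 1 = X ^ m * Δ ^ (-(m * p)) ⊓ Δ ^ (m : ℤ) := by
  apply le_antisymm
  · have := (hΔ.le_iterate_cyclingStep_iff X p m _ 1).1 le_rfl
    refine le_inf ?_ ?_
    · simpa using this m 0 (by omega)
    · simpa using this 0 m (by omega)
  -- After multiplication by `S`, the `m`-th power of the `N`-th iterate, the terms have `i + j = m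
  -- * N + m`. Since `m ≤ m * N`, either `i ≥ m`, and `X ^ m` can be split off because `S` commutes
  -- with `X`, or `j ≥ m`, and `Δ ^ m` can.
  · rw [← mul_le_mul_iff_left (((cyclingStep Δ X p)^[N] 1) ^ m), ← iterate_cyclingStep_period h,
      hΔ.le_iterate_cyclingStep_iff]
    intro i j hij
    have hT : ∀ i j : ℕ, i + j = m * N →
        ((cyclingStep Δ X p)^[N] 1) ^ m ≤ X ^ i * Δ ^ ((j : ℤ) - i * p) := by
      intro i j hij
      have e := iterate_cyclingStep_period h m 0
      simp only [add_zero, Function.iterate_zero, id, mul_one] at e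
      simpa using (hΔ.le_iterate_cyclingStep_iff X p (m * N) _ 1).1 e.ge i j hij
    have hc := h.pow_right m
    have hmN : m ≤ m * N := Nat.le_mul_of_pos_right m hN
    generalize ((cyclingStep Δ X p)^[N] 1) ^ m = S at *
    rw [mul_one]
    by_cases him : m ≤ i
    · obtain ⟨i, rfl⟩ := Nat.exists_eq_add_of_le him
      have h1 := hT i j (by omega)
      calc S * (X ^ m * Δ ^ (-(m * p)) ⊓ Δ ^ (m : ℤ)) ≤ S * (X ^ m * Δ ^ (-(m * p))) := by
            gcongr; exact inf_le_left
        _ = X ^ m * S * Δ ^ (-(m * p)) := by rw [← mul_assoc, (hc.pow_left m).eq]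
        _ ≤ X ^ m * (X ^ i * Δ ^ ((j : ℤ) - i * p)) * Δ ^ (-(m * p)) := by
            rw [hΔ.mul_zpow_le_mul_zpow_iff]; gcongr
        _ = _ := by
            rw [← mul_assoc, ← pow_add, mul_assoc, ← zpow_add]
            congr 2
            push_cast
            ring
    · obtain ⟨j, rfl⟩ := Nat.exists_eq_add_of_le (show m ≤ j by omega)
      have h1 := hT i j (by omega)
      calc S * (X ^ m * Δ ^ (-(m * p)) ⊓ Δ ^ (m : ℤ)) ≤ S * Δ ^ (m : ℤ) := by
            gcongr; exact inf_le_right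
        _ ≤ X ^ i * Δ ^ ((j : ℤ) - i * p) * Δ ^ (m : ℤ) := by
            rw [hΔ.mul_zpow_le_mul_zpow_iff]; exact h1
        _ = _ := by
            rw [mul_assoc, ← zpow_add]
            congr 2
            push_cast
            ring

end IsGarsideElement

end Cycling

end Garside
namespace Garside

/-! ### Minimal length and cycling periods. -/

section UltraSummit

variable {G : Type*} [Group G] [Lattice G] {Δ : G}

/-- `X` lies between `Δ ^ p` and `Δ ^ (p + r)`, and no conjugate of `X` lies in such an interval
of length `r - 1`. -/
structure IsSummit (Δ X : G) (p : ℤ) (r : ℕ) : Prop where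
  zpow_le : Δ ^ p ≤ X
  le_zpow : X ≤ Δ ^ (p + r)
  minimal : ∀ (u : G) (q : ℤ), Δ ^ q ≤ u⁻¹ * X * u → ¬ u⁻¹ * X * u ≤ Δ ^ (q + r - 1)

theorem IsSummit.conj {X : G} {p : ℤ} {r : ℕ} (h : IsSummit Δ X p r) (s : G)
    (h1 : Δ ^ p ≤ s⁻¹ * X * s) (h2 : s⁻¹ * X * s ≤ Δ ^ (p + r)) :
    IsSummit Δ (s⁻¹ * X * s) p r := by
  refine ⟨h1, h2, fun u q => ?_⟩
  have := h.minimal (s * u) q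
  simpa only [mul_inv_rev, mul_assoc] using this

theorem IsSummit.ne_one {X : G} {p : ℤ} {r : ℕ} (h : IsSummit Δ X p r) : Δ ≠ 1 := by
  rintro rfl
  have := h.minimal 1 0
  have h1 := h.zpow_le
  have h2 := h.le_zpow
  simp only [one_zpow, inv_one, one_mul, mul_one] at *
  exact this h1 h2

/-- For `X` in its ultra summit set, of infimum `p`, the product of the conjugating elements of the
first `m` cyclings of `X`. -/
def cyclingProduct (Δ X : G) (p : ℤ) (m : ℕ) : G := X ^ m * Δ ^ (-(m * p)) ⊓ Δ ^ (m : ℤ)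

/-- `N` is a period of the cycling of `X`. -/
structure IsCyclingPeriod (Δ X : G) (p : ℤ) (N : ℕ) : Prop where
  commute : Commute X (cyclingProduct Δ X p N)
  mul_eq : ∀ k, cyclingProduct Δ X p (k * N) = cyclingProduct Δ X p N ^ k

theorem IsCyclingPeriod.mul {X : G} {p : ℤ} {N : ℕ} (h : IsCyclingPeriod Δ X p N) (j : ℕ) :
    IsCyclingPeriod Δ X p (j * N) := by
  refine ⟨?_, fun k => ?_⟩
  · rw [h.mul_eq]; exact h.commute.pow_right j
  · rw [← mul_assoc, h.mul_eq, h.mul_eq, ← pow_mul, mul_comm]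

variable [MulLeftMono G]

namespace IsGarsideElement

theorem isSummit_of_mem_superSummitSet (hΔ : IsGarsideElement Δ) (hne : Δ ≠ 1) {X Y : G}
    (hY : Y ∈ superSummitSet Δ X) : IsSummit Δ Y (infimum Δ Y) (canonicalLength Δ Y) := by
  refine ⟨hΔ.zpow_infimum_le hne Y, hΔ.le_zpow_infimum_add hne Y, fun u q h1 h2 => ?_⟩
  have h3 := hΔ.le_infimum hne h1
  have h4 := hΔ.canonicalLength_le hne h2
  have h5 := hY.2 (u⁻¹ * Y * u) (hY.1.trans (isConj_iff.2 ⟨u⁻¹, by simp⟩))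
  omega

theorem infimum_eq_of_isSummit (hΔ : IsGarsideElement Δ) {X : G} {p : ℤ} {r : ℕ}
    (h : IsSummit Δ X p r) : infimum Δ X = p := by
  refine le_antisymm ?_ (hΔ.le_infimum h.ne_one h.zpow_le)
  by_contra! hlt
  have h1 : Δ ^ (p + 1) ≤ X := (hΔ.zpow_le_zpow (by omega)).trans (hΔ.zpow_infimum_le h.ne_one X)
  refine h.minimal 1 (p + 1) (by simpa using h1) ?_
  rw [show p + 1 + (r : ℤ) - 1 = p + r by ring]
  simpa using h.le_zpow

/-- Conjugate elements that lie in intervals of the least possible length have the same infimum. -/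
theorem isSummit_unique (hΔ : IsGarsideElement Δ) {X s : G} {p q : ℤ} {r : ℕ}
    (hX : IsSummit Δ X p r) (hY : IsSummit Δ (s⁻¹ * X * s) q r) : p = q := by
  apply le_antisymm
  · by_contra! hlt
    obtain ⟨u, h1, h2⟩ := hΔ.exists_conj_of_zpow_le_conj (q := q + 1) (s := s⁻¹) hY.le_zpow (by
      refine (hΔ.zpow_le_zpow (by omega)).trans (hX.zpow_le.trans_eq ?_)
      group)
    exact hY.minimal u _ h1 (by rwa [show q + 1 + (r : ℤ) - 1 = q + r by ring])
  · by_contra! hlt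
    obtain ⟨u, h1, h2⟩ := hΔ.exists_conj_of_zpow_le_conj (q := p + 1) (s := s) hX.le_zpow
      ((hΔ.zpow_le_zpow (by omega)).trans hY.zpow_le)
    exact hX.minimal u _ h1 (by rwa [show p + 1 + (r : ℤ) - 1 = p + r by ring])

theorem isSummit_cycling (hΔ : IsGarsideElement Δ) {X : G} {p : ℤ} {r : ℕ} (hr : 0 < r)
    (h : IsSummit Δ X p r) : IsSummit Δ (cycling Δ X) p r := by
  have hi : initialFactor Δ X = X * Δ ^ (-p) ⊓ Δ := by
    rw [hΔ.initialFactor_eq h.ne_one, hΔ.infimum_eq_of_isSummit h]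
  have hB : 1 ≤ X * Δ ^ (-p) := by rw [hΔ.le_mul_zpow_iff, neg_neg, one_mul]; exact h.zpow_le
  have e : X * (X * Δ ^ (-p) ⊓ Δ) = X * (X * Δ ^ (-p)) ⊓ X * Δ ^ (1 : ℤ) := by
    rw [mul_inf, zpow_one]
  rw [cycling, hi]
  apply h.conj
  · rw [mul_assoc, le_inv_mul_iff_mul_le, hΔ.mul_zpow_le_iff, e, hΔ.inf_mul_zpow]
    refine inf_le_left.trans (le_inf ?_ ?_)
    · rw [hΔ.mul_zpow_le_mul_zpow_iff]
      exact (le_mul_iff_one_le_right' X).2 hB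
    · rw [mul_assoc, ← zpow_add, mul_le_mul_iff_left]
      exact hΔ.zpow_le_zpow (by omega)
  · rw [mul_assoc, inv_mul_le_iff_le_mul, hΔ.le_mul_zpow_iff, e, hΔ.inf_mul_zpow]
    refine inf_le_right.trans (le_inf ?_ ?_)
    · rw [mul_assoc, ← zpow_add, mul_le_mul_iff_left]
      exact hΔ.zpow_le_zpow (by omega)
    · rw [hΔ.mul_zpow_le_iff, hΔ.mul_zpow_le_iff]
      refine h.le_zpow.trans_eq ?_
      rw [← zpow_one_add, ← zpow_add]
      congr 1
      ring

theorem iterate_cycling (hΔ : IsGarsideElement Δ) {X : G} {p : ℤ} {r : ℕ} (hr : 0 < r)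
    (h : IsSummit Δ X p r) (k : ℕ) :
    IsSummit Δ ((cycling Δ)^[k] X) p r ∧ (cycling Δ)^[k] X =
      ((cyclingStep Δ X p)^[k] 1)⁻¹ * X * (cyclingStep Δ X p)^[k] 1 := by
  induction k with
  | zero => simpa using h
  | succ k ih =>
    obtain ⟨h1, h2⟩ := ih
    rw [Function.iterate_succ_apply', Function.iterate_succ_apply']
    refine ⟨hΔ.isSummit_cycling hr h1, ?_⟩
    rw [cycling, hΔ.initialFactor_eq h1.ne_one, hΔ.infimum_eq_of_isSummit h1, h2]
    generalize (cyclingStep Δ X p)^[k] 1 = C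
    -- The meet on the right is the initial factor of `C⁻¹ * X * C`.
    have e : cyclingStep Δ X p C = C * (C⁻¹ * X * C * Δ ^ (-p) ⊓ Δ) := by
      rw [mul_inf, cyclingStep]
      simp only [mul_assoc, mul_inv_cancel_left]
    rw [e]
    simp only [mul_inv_rev, mul_assoc]

end IsGarsideElement

theorem IsGarsideElement.isCyclingPeriod (hΔ : IsGarsideElement Δ) {X : G} {p : ℤ} {r : ℕ}
    (hr : 0 < r) (h : IsSummit Δ X p r) {N : ℕ} (hN : 0 < N) (hX : (cycling Δ)^[N] X = X) :
    IsCyclingPeriod Δ X p N := by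
  have hc : Commute X ((cyclingStep Δ X p)^[N] 1) := by
    have e := (hΔ.iterate_cycling hr h N).2
    rw [hX, mul_assoc, eq_inv_mul_iff_mul_eq] at e
    exact e.symm
  have e := hΔ.iterate_cyclingStep_eq hN hc
  refine ⟨?_, fun k => ?_⟩
  · rw [cyclingProduct, ← e]; exact hc
  · rw [cyclingProduct, cyclingProduct, ← e, ← e]
    simpa using iterate_cyclingStep_period hc k 0

end UltraSummit

end Garside
namespace Garside

/-! ### Rigidity up to central powers of `Δ`. -/

section PureRigid

variable {G : Type*} [Group G] [Lattice G] {Δ : G}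

/-- `Z` has infimum `0` and length at most `n`, where `Δ ^ n` is central, and the first `n` factors
of `Z * Z` form `Z`. -/
structure IsPureRigid (Δ Z : G) (n : ℕ) : Prop where
  central : ∀ g, Commute (Δ ^ (n : ℤ)) g
  one_le : 1 ≤ Z
  le_zpow : Z ≤ Δ ^ (n : ℤ)
  not_le : ¬ Δ ≤ Z
  ne_one : Z ≠ 1
  mul_self_inf : Z * Z ⊓ Δ ^ (n : ℤ) = Z

namespace IsPureRigid

variable {Z : G} {n : ℕ}

theorem pos (h : IsPureRigid Δ Z n) : 0 < n := by
  rcases Nat.eq_zero_or_pos n with rfl | hn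
  · exact absurd (le_antisymm (by simpa using h.le_zpow) h.one_le) h.ne_one
  · exact hn

variable [MulLeftMono G]

theorem pow_succ_inf (hΔ : IsGarsideElement Δ) (h : IsPureRigid Δ Z n) (j : ℕ) :
    Z ^ (j + 1) ⊓ Δ ^ (n : ℤ) = Z := by
  induction j with
  | zero => simpa using h.le_zpow
  | succ j ih =>
    apply le_antisymm
    · conv_rhs => rw [← h.mul_self_inf]
      refine le_inf ?_ inf_le_right
      rw [pow_succ' Z (j + 1)]
      conv_rhs => rw [← ih]
      rw [mul_inf]
      refine le_inf ?_ ?_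
      · conv_rhs => rw [ih]
        exact inf_le_left
      · conv_rhs => rw [ih]
        refine inf_le_right.trans ?_
        rw [hΔ.le_mul_zpow_iff, ← zpow_add, add_neg_cancel, zpow_zero]
        exact h.one_le
    · refine le_inf ?_ h.le_zpow
      rw [pow_succ' Z, le_mul_iff_one_le_right']
      exact one_le_pow_of_one_le' h.one_le _

theorem pow_inf (hΔ : IsGarsideElement Δ) (h : IsPureRigid Δ Z n) {i j : ℕ} (hij : i ≤ j) :
    Z ^ j ⊓ Δ ^ ((i * n : ℕ) : ℤ) = Z ^ i := by
  induction i with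
  | zero => simpa using one_le_pow_of_one_le' h.one_le j
  | succ i ih =>
    obtain ⟨k, rfl⟩ := Nat.exists_eq_add_of_le hij
    rw [add_mul, one_mul, Nat.cast_add, hΔ.inf_zpow_add _ _ (by omega), ih (by omega)]
    rw [show i + 1 + k = i + (k + 1) by ring, pow_add Z i, inv_mul_cancel_left,
      h.pow_succ_inf hΔ, pow_succ]

theorem pow_le (hΔ : IsGarsideElement Δ) (h : IsPureRigid Δ Z n) (k : ℕ) :
    Z ^ k ≤ Δ ^ ((k * n : ℕ) : ℤ) :=
  inf_eq_left.1 (h.pow_inf hΔ le_rfl)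

theorem not_le_pow (hΔ : IsGarsideElement Δ) (h : IsPureRigid Δ Z n) (k : ℕ) : ¬ Δ ≤ Z ^ k := by
  intro hk
  refine h.not_le ?_
  rw [← h.pow_succ_inf hΔ k]
  refine le_inf (hk.trans ?_) ?_
  · rw [pow_succ, le_mul_iff_one_le_right']
    exact h.one_le
  · have := h.pos
    simpa using hΔ.zpow_le_zpow (show (1 : ℤ) ≤ n by omega)

theorem pow_ne_one (h : IsPureRigid Δ Z n) {k : ℕ} (hk : k ≠ 0) : Z ^ k ≠ 1 := by
  intro e
  obtain ⟨k, rfl⟩ := Nat.exists_eq_succ_of_ne_zero hk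
  refine h.ne_one (le_antisymm ?_ h.one_le)
  rw [← e, pow_succ', le_mul_iff_one_le_right']
  exact one_le_pow_of_one_le' h.one_le _

theorem pow (hΔ : IsGarsideElement Δ) (h : IsPureRigid Δ Z n) {k : ℕ} (hk : k ≠ 0) :
    IsPureRigid Δ (Z ^ k) (k * n) := by
  refine ⟨fun g => ?_, one_le_pow_of_one_le' h.one_le k, h.pow_le hΔ k, h.not_le_pow hΔ k,
    h.pow_ne_one hk, ?_⟩
  · rw [mul_comm, Nat.cast_mul, zpow_mul]
    exact (h.central g).zpow_left _
  · rw [← pow_add]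
    exact h.pow_inf hΔ (by omega)

/-- Up to a central factor this is the inverse of `Z`; it serves for rigid powers with negative
exponent. -/
theorem inv_mul_zpow (hΔ : IsGarsideElement Δ) (h : IsPureRigid Δ Z n) :
    IsPureRigid Δ (Z⁻¹ * Δ ^ (n : ℤ)) n := by
  refine ⟨h.central, one_le_inv_mul_iff.2 h.le_zpow, ?_, fun hle => ?_, fun he => ?_, ?_⟩
  · rw [inv_mul_le_iff_le_mul, hΔ.le_mul_zpow_iff, ← zpow_add, add_neg_cancel, zpow_zero]
    exact h.one_le
  · rw [le_inv_mul_iff_mul_le] at hle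
    refine h.ne_one (hΔ.eq_one_of_inf_eq_one h.one_le h.le_zpow
      (le_antisymm ?_ (le_inf h.one_le hΔ.one_le)))
    rw [← mul_le_mul_iff_left Z, mul_one]
    conv_rhs => rw [← h.mul_self_inf]
    refine le_inf ?_ ?_
    · gcongr; exact inf_le_left
    · refine le_trans ?_ hle
      gcongr
      exact inf_le_right
  · have hZ : Z = Δ ^ (n : ℤ) := by simpa [inv_mul_eq_one] using he
    refine h.not_le ?_
    rw [hZ]
    have := h.pos
    simpa using hΔ.zpow_le_zpow (show (1 : ℤ) ≤ n by omega)
  · rw [← mul_right_inj (Z * Z), mul_inf]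
    have e1 : Z * Z * (Z⁻¹ * Δ ^ (n : ℤ) * (Z⁻¹ * Δ ^ (n : ℤ))) = 1 * Δ ^ (n : ℤ) * Δ ^ (n : ℤ) := by
      rw [show Z * Z * (Z⁻¹ * Δ ^ (n : ℤ) * (Z⁻¹ * Δ ^ (n : ℤ))) =
        Z * (Δ ^ (n : ℤ) * Z⁻¹) * Δ ^ (n : ℤ) by group, (h.central Z⁻¹).eq,
        mul_inv_cancel_left, one_mul]
    have e2 : Z * Z * (Z⁻¹ * Δ ^ (n : ℤ)) = Z * Δ ^ (n : ℤ) := by group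
    rw [e1, e2, ← hΔ.inf_mul_zpow, inf_comm, one_mul, h.mul_self_inf]

theorem isRigid (hΔ : IsGarsideElement Δ) (h : IsPureRigid Δ Z n) {c : ℤ}
    (hc : ∀ g, Commute (Δ ^ c) g) : IsRigid Δ (Δ ^ c * Z) := by
  obtain ⟨l, hl, hlen, hne, hg⟩ := hΔ.exists_isGreedy h.one_le h.le_zpow
  cases l with
  | nil => exact absurd hl.symm h.ne_one
  | cons x t =>
    have hx : x = Z ⊓ Δ := by rw [← hl]; exact hg x t (List.suffix_refl _)
    have hx1 : 1 ≤ x := by rw [hx]; exact le_inf h.one_le hΔ.one_le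
    have hZx : Z * x ⊓ Δ ^ (n : ℤ) = Z := by
      apply le_antisymm
      · conv_rhs => rw [← h.mul_self_inf]
        gcongr
        rw [hx]; exact inf_le_left
      · exact le_inf ((le_mul_iff_one_le_right' Z).2 hx1) h.le_zpow
    have hn := h.pos
    refine ⟨c, x, t, ⟨by rw [hl], by rw [hl]; exact h.one_le, by rw [hl]; exact h.not_le, hne, hg⟩,
      ?_⟩
    rw [(hc x).eq, mul_inv_cancel_right]
    have hprod : (x :: t ++ [x]).prod = Z * x := by
      rw [List.prod_append, hl, List.prod_singleton]
    refine ⟨by rw [hprod, mul_assoc], ?_, ?_, ?_, ?_⟩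
    · rw [hprod]
      exact h.one_le.trans ((le_mul_iff_one_le_right' Z).2 hx1)
    · rw [hprod]
      intro hle
      refine h.not_le ?_
      rw [← hZx]
      refine le_inf hle ?_
      simpa using hΔ.zpow_le_zpow (show (1 : ℤ) ≤ n by omega)
    · intro y hy
      rcases List.mem_append.1 hy with hy | hy
      · exact hne y hy
      · rw [List.mem_singleton.1 hy]; exact hne x (by simp)
    · intro y u hu
      obtain ⟨v, hv⟩ := hu
      rcases List.eq_nil_or_concat u with rfl | ⟨w, z, rfl⟩
      · obtain ⟨-, hyx⟩ := List.append_inj' hv rfl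
        obtain rfl : y = x := by simpa using hyx
        rw [List.prod_singleton, eq_comm, inf_eq_left, hx]
        exact inf_le_right
      · rw [List.concat_eq_append, ← List.cons_append, ← List.append_assoc] at hv
        obtain ⟨hvl, hzx⟩ := List.append_inj' hv rfl
        obtain rfl : z = x := by simpa using hzx
        have hyw : y = (y :: w).prod ⊓ Δ := hg y w ⟨v, hvl⟩
        have hvlen : v.length + 1 ≤ n := by
          have := congrArg List.length hvl
          simp only [List.length_append, List.length_cons] at this hlen
          omega
        have hvprod : v.prod * (y :: w).prod = Z := by rw [← hl, ← hvl, List.prod_append]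
        have hvle : v.prod ≤ Δ ^ (v.length : ℤ) := by
          have hg' : IsGreedy Δ (v ++ y :: w) := by rw [hvl]; exact hg
          rw [← IsGreedy.append_prod_inf hΔ hg' (by rw [hvl, hl]; exact h.one_le)]
          exact inf_le_right
        rw [List.concat_eq_append, ← List.cons_append, List.prod_append, List.prod_singleton]
        apply le_antisymm
        · conv_lhs => rw [hyw]
          gcongr
          exact (le_mul_iff_one_le_right' _).2 hx1
        -- A simple prefix of `(y :: w).prod * x`, preceded by `v`, is a prefix of both `Z * x` and
        -- `Δ ^ n`, as `v.length + 1 ≤ n`. Hence by `hZx` it is already a prefix of `(y :: w).prod`.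
        · conv_rhs => rw [hyw]
          refine le_inf ?_ inf_le_right
          rw [← mul_le_mul_iff_left v.prod, hvprod]
          conv_rhs => rw [← hZx]
          refine le_inf ?_ ?_
          · rw [← hvprod, mul_assoc]
            gcongr
            exact inf_le_left
          · calc _ ≤ v.prod * Δ ^ (1 : ℤ) := by
                  gcongr; rw [zpow_one]; exact inf_le_right
              _ ≤ Δ ^ (v.length : ℤ) * Δ ^ (1 : ℤ) := (hΔ.mul_zpow_le_mul_zpow_iff _).2 hvle
              _ = Δ ^ ((v.length : ℤ) + 1) := (zpow_add ..).symm
              _ ≤ _ := hΔ.zpow_le_zpow (by omega)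

end IsPureRigid

end PureRigid

end Garside
namespace Garside

/-! ### Transporting a rigid power to a conjugate. -/

section RigidPower

variable {G : Type*} [Group G] [Lattice G] [MulLeftMono G] {Δ : G}

namespace IsGarsideElement

/-- The product of the first `i * r` factors of a power of a rigid element of length `r`. -/
theorem pow_mul_zpow_inf (hΔ : IsGarsideElement Δ) {W : G} {p : ℤ} {r : ℕ} (hp : Δ ^ p ≤ W)
    (h1 : W * Δ ^ (-p) ≤ Δ ^ (r : ℤ))
    (h2 : W * (W * Δ ^ (-p)) * Δ ^ (-p) ⊓ Δ ^ (r : ℤ) = W * Δ ^ (-p)) {i j : ℕ} (hij : i ≤ j) :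
    W ^ j * Δ ^ (-(j * p)) ⊓ Δ ^ ((i * r : ℕ) : ℤ) = W ^ i * Δ ^ (-(i * p)) := by
  have hB : 1 ≤ W * Δ ^ (-p) := by rw [hΔ.le_mul_zpow_iff, neg_neg, one_mul]; exact hp
  have hstep : ∀ k : ℕ, W ^ (k + 1) * Δ ^ (-((k + 1 : ℕ) * p)) =
      W * (W ^ k * Δ ^ (-(k * p))) * Δ ^ (-p) := by
    intro k
    rw [pow_succ']
    simp only [mul_assoc, ← zpow_add]
    congr 3
    push_cast
    ring
  have hone : ∀ k : ℕ, 1 ≤ W ^ k * Δ ^ (-(k * p)) := by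
    intro k
    induction k with
    | zero => simp
    | succ k ih =>
      rw [hstep]
      refine hB.trans ?_
      rw [hΔ.mul_zpow_le_mul_zpow_iff, le_mul_iff_one_le_right']
      exact ih
  have hfirst : ∀ k : ℕ, W ^ (k + 1) * Δ ^ (-((k + 1 : ℕ) * p)) ⊓ Δ ^ (r : ℤ) =
      W * Δ ^ (-p) := by
    intro k
    induction k with
    | zero => simpa using h1
    | succ k ih =>
      have e : Δ ^ (r : ℤ) ≤ W * Δ ^ (r : ℤ) * Δ ^ (-p) := by
        rw [mul_assoc, ← zpow_add, add_comm, zpow_add, ← mul_assoc]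
        conv_lhs => rw [← one_mul (Δ ^ (r : ℤ))]
        exact (hΔ.mul_zpow_le_mul_zpow_iff _).2 hB
      rw [hstep, ← inf_eq_right.2 e, ← inf_assoc, ← hΔ.inf_mul_zpow, ← mul_inf, ih, h2]
  obtain ⟨k, rfl⟩ := Nat.exists_eq_add_of_le hij
  clear hij
  induction i generalizing k with
  | zero => simpa using hone k
  | succ i ih =>
    have e : W * Δ ^ ((i * r : ℕ) : ℤ) * Δ ^ (-p) =
        (W ^ (i + k + 1) * Δ ^ (-((i + k + 1 : ℕ) * p))) * Δ ^ ((i * r : ℕ) : ℤ) ⊓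
          Δ ^ (((i + 1) * r : ℕ) : ℤ) := by
      rw [mul_assoc, ← zpow_add, add_comm, zpow_add, ← mul_assoc, ← hfirst (i + k),
        hΔ.inf_mul_zpow, ← zpow_add]
      congr 2
      push_cast
      ring
    have hle : W ^ (i + k + 1) * Δ ^ (-((i + k + 1 : ℕ) * p)) ≤
        (W ^ (i + k + 1) * Δ ^ (-((i + k + 1 : ℕ) * p))) * Δ ^ ((i * r : ℕ) : ℤ) :=
      (le_mul_iff_one_le_right' _).2 (hΔ.one_le_zpow (by omega))
    have h3 := congrArg (fun u => W * u * Δ ^ (-p)) (ih k)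
    simp only [mul_inf, hΔ.inf_mul_zpow] at h3
    rw [e, ← hstep, ← hstep, ← inf_assoc, inf_eq_left.2 hle] at h3
    rw [show i + 1 + k = i + k + 1 by ring]
    exact h3

theorem exists_isPureRigid_of_isRigid (hΔ : IsGarsideElement Δ) {W : G} (hW : IsRigid Δ W) :
    ∃ (k : ℕ) (a : ℤ) (n : ℕ), 0 < k ∧ (∀ g, Commute (Δ ^ a) g) ∧
      IsPureRigid Δ (W ^ k * Δ ^ (-a)) n := by
  obtain ⟨p, x, t, hX, hXX⟩ := hW
  obtain ⟨e, he, hc⟩ := hΔ.exists_zpow_central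
  have hxQ : x = (x :: t).prod ⊓ Δ := hX.factor x t (List.suffix_refl _)
  have hxne : x ≠ 1 := hX.ne_one x (by simp)
  have hQ : (x :: t).prod * (Δ ^ p * x * (Δ ^ p)⁻¹) ⊓ Δ ^ ((x :: t).length : ℤ) = (x :: t).prod := by
    have := IsGreedy.append_prod_inf hΔ hXX.factor hXX.one_le_prod
    rwa [List.prod_append, List.prod_singleton] at this
  have hWQ := hX.eq_prod
  have hQ1 := hX.one_le_prod
  have hQΔ := hX.not_le_prod
  have hr : 0 < (x :: t).length := by simp
  generalize (x :: t).prod = Q at *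
  generalize (x :: t).length = r at *
  have hp : Δ ^ p ≤ W := by rw [hWQ]; exact (le_mul_iff_one_le_right' _).2 hQ1
  have hBΔ : ¬ Δ ≤ W * Δ ^ (-p) := by
    rw [hΔ.le_mul_zpow_iff, neg_neg, ← zpow_one_add, add_comm, zpow_add_one, hWQ,
      mul_le_mul_iff_left]
    exact hQΔ
  have hι : Δ ^ p * x * (Δ ^ p)⁻¹ = W * Δ ^ (-p) ⊓ Δ := by
    rw [hxQ, mul_inf, ← zpow_neg, hΔ.inf_mul_zpow, ← hWQ, ← zpow_add_one, ← zpow_add]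
    simp
  rw [hι] at hQ
  have hιW : W * (W * Δ ^ (-p) ⊓ Δ) * Δ ^ (-p) ⊓ Δ ^ (r : ℤ) = W * Δ ^ (-p) := by
    have h : Δ ^ p * (Q * (W * Δ ^ (-p) ⊓ Δ) ⊓ Δ ^ (r : ℤ)) * Δ ^ (-p) = Δ ^ p * Q * Δ ^ (-p) := by
      rw [hQ]
    rw [mul_inf _ _ (Δ ^ p), hΔ.inf_mul_zpow, ← mul_assoc, ← hWQ, ← zpow_add, ← zpow_add] at h
    simpa using h
  have hBr : W * Δ ^ (-p) ≤ Δ ^ (r : ℤ) := inf_eq_left.1 (by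
    conv_lhs => rw [← hιW]
    rw [inf_assoc, inf_idem, hιW])
  have hB1 : 1 ≤ W * Δ ^ (-p) := by rw [hΔ.le_mul_zpow_iff, neg_neg, one_mul]; exact hp
  -- Rigidity speaks of one further factor only. If a whole further block enlarged the meet, the
  -- excess would have a nontrivial simple prefix, and one factor would suffice to enlarge it.
  have h2 : W * (W * Δ ^ (-p)) * Δ ^ (-p) ⊓ Δ ^ (r : ℤ) = W * Δ ^ (-p) := by
    set g := W * (W * Δ ^ (-p)) * Δ ^ (-p) ⊓ Δ ^ (r : ℤ) with hg
    have hBg : W * Δ ^ (-p) ≤ g := le_inf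
      ((hΔ.mul_zpow_le_mul_zpow_iff _).2 ((le_mul_iff_one_le_right' W).2 hB1)) hBr
    have hh1 : 1 ≤ (W * Δ ^ (-p))⁻¹ * g := one_le_inv_mul_iff.2 hBg
    have hhr : (W * Δ ^ (-p))⁻¹ * g ≤ Δ ^ (r : ℤ) := by
      rw [inv_mul_le_iff_le_mul]
      refine inf_le_right.trans ?_
      conv_lhs => rw [← one_mul (Δ ^ (r : ℤ))]
      exact (hΔ.mul_zpow_le_mul_zpow_iff _).2 hB1
    have hhΔ : (W * Δ ^ (-p))⁻¹ * g ⊓ Δ = 1 := by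
      refine le_antisymm ?_ (le_inf hh1 hΔ.one_le)
      rw [← mul_le_mul_iff_left (W * Δ ^ (-p)), mul_one, mul_inf, mul_inv_cancel_left]
      refine le_trans ?_ hιW.le
      refine le_inf ?_ (inf_le_left.trans inf_le_right)
      rw [mul_inf _ _ W, hΔ.inf_mul_zpow]
      refine inf_le_inf inf_le_left (le_of_eq ?_)
      rw [mul_assoc, mul_assoc, ← zpow_add_one, ← zpow_one_add, add_comm]
    have := hΔ.eq_one_of_inf_eq_one hh1 hhr hhΔ
    exact (inv_mul_eq_one.1 this).symm
  have key := fun {i j : ℕ} (hij : i ≤ j) => hΔ.pow_mul_zpow_inf hp hBr h2 hij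
  have hfirst : W ^ e * Δ ^ (-(e * p)) ⊓ Δ ^ (r : ℤ) = W * Δ ^ (-p) := by
    simpa using key (show 1 ≤ e from he)
  have hcp : ∀ k : ℤ, ∀ g, Commute (Δ ^ (e * k : ℤ)) g := fun k g => by
    rw [zpow_mul]; exact (hc g).zpow_left k
  refine ⟨e, e * p, e * r, he, hcp p, ⟨?_, ?_, ?_, ?_, ?_, ?_⟩⟩
  · intro g
    exact_mod_cast hcp r g
  · refine hB1.trans ?_
    rw [← hfirst]
    exact inf_le_left
  · exact inf_eq_left.1 (key le_rfl)
  · intro hle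
    refine hBΔ ?_
    rw [← hfirst]
    refine le_inf hle ?_
    simpa using hΔ.zpow_le_zpow (show (1 : ℤ) ≤ r by omega)
  · intro he1
    rw [he1, inf_eq_left.2 (hΔ.one_le_zpow (by omega))] at hfirst
    rw [← hfirst, inf_eq_left.2 hΔ.one_le] at hι
    exact hxne (by simpa using hι)
  · have e2 : W ^ e * Δ ^ (-(e * p : ℤ)) * (W ^ e * Δ ^ (-(e * p : ℤ))) =
        W ^ (e + e) * Δ ^ (-((e + e : ℕ) * p)) := by
      have := hcp (-p) (W ^ e)
      rw [mul_neg] at this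
      rw [mul_assoc, ← mul_assoc (Δ ^ _), this.eq, mul_assoc, ← mul_assoc, ← pow_add, ← zpow_add]
      congr 2
      push_cast
      ring
    rw [e2]
    exact key (by omega)

theorem exists_isPureRigid_of_hasRigidPower (hΔ : IsGarsideElement Δ) {X : G}
    (hX : HasRigidPower Δ X) :
    ∃ (M : ℕ) (a : ℤ) (n : ℕ), 0 < M ∧ (∀ g, Commute (Δ ^ a) g) ∧
      IsPureRigid Δ (X ^ M * Δ ^ (-a)) n := by
  obtain ⟨m, hm, hr⟩ := hX
  obtain ⟨k, a, n, hk, hc, h⟩ := hΔ.exists_isPureRigid_of_isRigid hr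
  obtain ⟨M, rfl | rfl⟩ := Int.eq_nat_or_neg m
  · refine ⟨M * k, a, n, Nat.mul_pos (by omega) hk, hc, ?_⟩
    rwa [zpow_natCast, ← pow_mul] at h
  · refine ⟨M * k, -(a + n), n, Nat.mul_pos (by omega) hk, fun g => ?_, ?_⟩
    · rw [zpow_neg, zpow_add]
      exact ((hc g).mul_left (h.central g)).inv_left
    · have h' := h.inv_mul_zpow hΔ
      rw [zpow_neg, inv_pow, zpow_natCast, ← pow_mul, mul_inv_rev, inv_inv, zpow_neg, inv_inv,
        (hc _).eq, mul_assoc, ← zpow_add] at h'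
      rwa [neg_neg]

/-- The conjugating elements of the cyclings of conjugate elements are eventually conjugate. -/
theorem exists_cyclingProduct_conj (hΔ : IsGarsideElement Δ) {X s : G} {p : ℤ} {N : ℕ}
    (hX : IsCyclingPeriod Δ X p N) (hY : IsCyclingPeriod Δ (s⁻¹ * X * s) p N) :
    ∃ j, 0 < j ∧ cyclingProduct Δ (s⁻¹ * X * s) p (j * N) =
      s⁻¹ * cyclingProduct Δ X p (j * N) * s := by
  obtain ⟨K, hK1, hK2⟩ := hΔ.exists_zpow_bounds s
  have hs : ∀ m, s * cyclingProduct Δ (s⁻¹ * X * s) p m =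
      X ^ m * s * Δ ^ (-(m * p)) ⊓ s * Δ ^ (m : ℤ) := by
    intro m
    have : (s⁻¹ * X * s) ^ m = s⁻¹ * X ^ m * s := by simpa using conj_pow (a := s⁻¹) (b := X) (i := m)
    rw [cyclingProduct, mul_inf, this]
    simp only [mul_assoc, mul_inv_cancel_left]
  have hs' : ∀ (m : ℕ) (L : ℤ), cyclingProduct Δ X p m * Δ ^ L =
      X ^ m * Δ ^ L * Δ ^ (-(m * p)) ⊓ Δ ^ L * Δ ^ (m : ℤ) := by
    intro m L
    rw [cyclingProduct, hΔ.inf_mul_zpow]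
    simp only [mul_assoc, ← zpow_add, add_comm]
  -- Replacing `s` by its bounds `Δ ^ (-K)` and `Δ ^ K` in `hs` gives the two meets of `hs'`, so
  -- these quotients stay in a finite interval and two of them coincide.
  have hmem : ∀ k : ℕ, (cyclingProduct Δ X p (k * N))⁻¹ *
      (s * cyclingProduct Δ (s⁻¹ * X * s) p (k * N)) ∈ Set.Icc (Δ ^ (-K : ℤ)) (Δ ^ (K : ℤ)) := by
    intro k
    constructor
    · rw [le_inv_mul_iff_mul_le, hs, hs']
      refine inf_le_inf ?_ ?_
      · rw [hΔ.mul_zpow_le_mul_zpow_iff, mul_le_mul_iff_left]; exact hK1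
      · rw [hΔ.mul_zpow_le_mul_zpow_iff]; exact hK1
    · rw [inv_mul_le_iff_le_mul, hs, hs']
      refine inf_le_inf ?_ ?_
      · rw [hΔ.mul_zpow_le_mul_zpow_iff, mul_le_mul_iff_left]; exact hK2
      · rw [hΔ.mul_zpow_le_mul_zpow_iff]; exact hK2
  obtain ⟨i, j, hij, h⟩ := (hΔ.finite_Icc _ _).exists_lt_map_eq_of_forall_mem hmem
  refine ⟨j - i, by omega, ?_⟩
  obtain ⟨k, rfl⟩ := Nat.exists_eq_add_of_le hij.le
  rw [add_tsub_cancel_left]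
  rw [hX.mul_eq, hX.mul_eq, hY.mul_eq, hY.mul_eq, pow_add, pow_add,
    (Commute.refl (cyclingProduct Δ (s⁻¹ * X * s) p N)).pow_pow i k |>.eq] at h
  have hcom := ((Commute.refl (cyclingProduct Δ X p N)).pow_pow i k).eq
  rw [hX.mul_eq, hY.mul_eq]
  generalize cyclingProduct Δ (s⁻¹ * X * s) p N ^ k = B at *
  generalize cyclingProduct Δ (s⁻¹ * X * s) p N ^ i = B' at *
  generalize cyclingProduct Δ X p N ^ i = A' at *
  generalize cyclingProduct Δ X p N ^ k = A at *
  have h' : A'⁻¹ * s * B' = (A' * A)⁻¹ * (s * B) * B' := by simpa only [mul_assoc] using h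
  have h3 := mul_right_cancel h'
  rw [hcom, mul_inv_rev, mul_assoc, mul_right_inj, eq_inv_mul_iff_mul_eq] at h3
  rw [mul_assoc, h3, inv_mul_cancel_left]

end IsGarsideElement

theorem IsCyclingPeriod.mul_zpow_pow {X : G} {p : ℤ} {N : ℕ} (hΔ : IsGarsideElement Δ)
    (h : IsCyclingPeriod Δ X p N) {b : ℤ} (hb : ∀ g, Commute (Δ ^ b) g) {c : ℤ}
    (hc : ∀ g, Commute (Δ ^ c) g) (hcb : c = N * p + b) {n : ℕ} (hn : (n : ℤ) = N - b) (k : ℕ) :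
    (cyclingProduct Δ X p N * Δ ^ (-b)) ^ k =
      (X ^ N * Δ ^ (-c)) ^ k ⊓ Δ ^ ((k * n : ℕ) : ℤ) := by
  have hb' : Commute (cyclingProduct Δ X p N) (Δ ^ (-b)) := by
    rw [zpow_neg]; exact (hb _).symm.inv_right
  have hc' : Commute (X ^ N) (Δ ^ (-c)) := by
    rw [zpow_neg]; exact (hc _).symm.inv_right
  rw [hb'.mul_pow, ← h.mul_eq, hc'.mul_pow, cyclingProduct, ← zpow_natCast (Δ ^ (-b)),
    ← zpow_natCast (Δ ^ (-c)), ← zpow_mul, ← zpow_mul, hΔ.inf_mul_zpow, mul_assoc, ← zpow_add,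
    ← zpow_add, ← pow_mul, mul_comm N k]
  congr 3
  · push_cast
    rw [hcb]
    ring
  · push_cast
    rw [hn]
    ring

/-- By `ht`, equal powers of `v = t⁻¹ * z` and `E = t⁻¹ * Δ ^ n` have trivial meet. Here `v ^ n = t
^ j` and `E ^ j` is the complement of `t ^ j` in `Δ ^ (j * n)`; multiplying their trivial meet by `t
^ j` gives rigidity. -/
theorem isPureRigid_pow_of_pow_eq (hΔ : IsGarsideElement Δ) {t z : G} {n j : ℕ}
    (hn : ∀ g, Commute (Δ ^ (n : ℤ)) g) (htz : Commute t z)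
    (ht : ∀ k, t ^ k = z ^ k ⊓ Δ ^ ((k * n : ℕ) : ℤ)) (hz : z ^ n = t ^ (n + j))
    (h1 : t ^ j ≠ 1) (h2 : t ^ j ≠ Δ ^ ((j * n : ℕ) : ℤ)) :
    IsPureRigid Δ (t ^ j) (j * n) := by
  have hcj : ∀ k : ℕ, ∀ g, Commute (Δ ^ ((k * n : ℕ) : ℤ)) g := fun k g => by
    rw [mul_comm, Nat.cast_mul, zpow_mul]; exact (hn g).zpow_left k
  have hv : ∀ k : ℕ, (t⁻¹ * z) ^ k = (t ^ k)⁻¹ * z ^ k := fun k => by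
    rw [htz.inv_left.mul_pow, inv_pow]
  have hE : ∀ k : ℕ, (t⁻¹ * Δ ^ (n : ℤ)) ^ k = (t ^ k)⁻¹ * Δ ^ ((k * n : ℕ) : ℤ) := fun k => by
    rw [(hn _).symm.mul_pow, inv_pow, ← zpow_natCast (Δ ^ (n : ℤ)), ← zpow_mul, mul_comm k,
      Nat.cast_mul]
  have htz1 : t ≤ z ⊓ Δ ^ (n : ℤ) := by simpa using (ht 1).le
  have hv1 : 1 ≤ t⁻¹ * z := one_le_inv_mul_iff.2 (htz1.trans inf_le_left)
  have hE1 : 1 ≤ t⁻¹ * Δ ^ (n : ℤ) := one_le_inv_mul_iff.2 (htz1.trans inf_le_right)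
  have hvn : (t⁻¹ * z) ^ n = t ^ j := by rw [hv, hz, pow_add, inv_mul_cancel_left]
  have hpos : 1 ≤ t ^ j := by rw [← hvn]; exact one_le_pow_of_one_le' hv1 n
  have hcop : t ^ j ⊓ (t ^ j)⁻¹ * Δ ^ ((j * n : ℕ) : ℤ) = 1 := by
    rw [← hE, ← hvn]
    refine le_antisymm ?_ (le_inf (one_le_pow_of_one_le' hv1 n) (one_le_pow_of_one_le' hE1 j))
    calc _ ≤ (t⁻¹ * z) ^ (n + j) ⊓ (t⁻¹ * Δ ^ (n : ℤ)) ^ (n + j) := by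
          refine inf_le_inf ?_ ?_
          · rw [pow_add, le_mul_iff_one_le_right']; exact one_le_pow_of_one_le' hv1 j
          · rw [add_comm, pow_add, le_mul_iff_one_le_right']; exact one_le_pow_of_one_le' hE1 n
      _ = 1 := by rw [hv, hE, ← mul_inf, ← ht, inv_mul_cancel]
  have hle : t ^ j ≤ Δ ^ ((j * n : ℕ) : ℤ) := by rw [ht j]; exact inf_le_right
  refine ⟨hcj j, hpos, hle, fun hΔt => h2 ?_, h1, ?_⟩
  · have hE0 : (t ^ j)⁻¹ * Δ ^ ((j * n : ℕ) : ℤ) = 1 := by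
      refine hΔ.eq_one_of_inf_eq_one (m := j * n) (one_le_inv_mul_iff.2 hle) ?_
        (le_antisymm ?_ (le_inf (one_le_inv_mul_iff.2 hle) hΔ.one_le))
      · rw [inv_mul_le_iff_le_mul, hΔ.le_mul_zpow_iff, ← zpow_add, add_neg_cancel, zpow_zero]
        exact hpos
      · rw [← hcop]
        exact le_inf (inf_le_right.trans hΔt) inf_le_left
    exact inv_mul_eq_one.1 hE0
  · have := congrArg (t ^ j * ·) hcop
    simpa only [mul_inf, mul_inv_cancel_left, mul_one] using this

/-- Conjugate elements with a common cycling period and conjugate cycling products. -/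
theorem hasRigidPower_of_cyclingProduct_conj (hΔ : IsGarsideElement Δ) {X s : G} {p c : ℤ}
    {r N R : ℕ} (hr : 1 < r) (hX : IsSummit Δ X p r) (hN : 0 < N)
    (hcN : ∀ g, Commute (Δ ^ (N : ℤ)) g) (hcc : ∀ g, Commute (Δ ^ c) g)
    (hXN : IsCyclingPeriod Δ X p N) (hYN : IsCyclingPeriod Δ (s⁻¹ * X * s) p N)
    (hs : cyclingProduct Δ (s⁻¹ * X * s) p N = s⁻¹ * cyclingProduct Δ X p N * s)
    (hZ : IsPureRigid Δ (X ^ N * Δ ^ (-c)) R) : HasRigidPower Δ (s⁻¹ * X * s) := by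
  obtain ⟨b, hcb⟩ : ∃ b, c = N * p + b := ⟨c - N * p, by ring⟩
  have hb : ∀ g, Commute (Δ ^ b) g := fun g => by
    rw [show b = c - N * p by omega, zpow_sub, zpow_mul]
    exact (hcc g).mul_left ((hcN g).zpow_left p).inv_left
  -- Otherwise `X ^ N` lies above `Δ ^ (N * (p + 1))`, and some conjugate of `X` has a larger
  -- infimum without a larger supremum.
  have hpos : b < N := by
    by_contra! hle
    obtain ⟨u, h1, h2⟩ := hΔ.exists_conj_of_zpow_le_pow (q := p + 1) hN hX.le_zpow (by
      refine (hΔ.zpow_le_zpow (show _ ≤ c by rw [hcb]; linarith)).trans ?_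
      have := hZ.one_le
      rwa [hΔ.le_mul_zpow_iff, neg_neg, one_mul] at this)
    exact hX.minimal u _ h1 (by rwa [show p + 1 + (r : ℤ) - 1 = p + r by ring])
  obtain ⟨n, hn⟩ := Int.eq_ofNat_of_zero_le (a := N - b) (by omega)
  -- Otherwise `X ^ N ≤ Δ ^ (N * (p + 1))`, and some conjugate of `X` lies between `Δ ^ p` and `Δ ^
  -- (p + 1)`, against `1 < r`.
  have hlt : n < R := by
    by_contra! hle
    obtain ⟨u, h1, h2⟩ := hΔ.exists_conj_of_pow_le_zpow (b := p + 1) hN hX.zpow_le (by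
      have := hZ.le_zpow
      rw [hΔ.mul_zpow_le_iff, neg_neg, ← zpow_add] at this
      refine this.trans (hΔ.zpow_le_zpow ?_)
      have e : (N : ℤ) * (p + 1) = N * p + N := by ring
      rw [e]
      omega)
    exact hX.minimal u _ h1 (h2.trans (hΔ.zpow_le_zpow (by omega)))
  obtain ⟨j, rfl⟩ := Nat.exists_eq_add_of_le hlt.le
  have hcn : ∀ g, Commute (Δ ^ (n : ℤ)) g := fun g => by
    rw [show (n : ℤ) = N - b by omega, zpow_sub]
    exact (hcN g).mul_left (hb g).inv_left
  have hXk := hXN.mul_zpow_pow hΔ hb hcc hcb hn.symm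
  have hYk := hYN.mul_zpow_pow hΔ hb hcc hcb hn.symm
  have hcomm : Commute (cyclingProduct Δ (s⁻¹ * X * s) p N * Δ ^ (-b))
      ((s⁻¹ * X * s) ^ N * Δ ^ (-c)) := by
    rw [zpow_neg, zpow_neg]
    exact ((hYN.commute.symm.pow_right N).mul_right (hcc _).symm.inv_right).mul_left
      (hb _).inv_left
  have hconj : ∀ (u : G) (d : ℤ), (∀ g, Commute (Δ ^ d) g) →
      s⁻¹ * u * s * Δ ^ (-d) = s⁻¹ * (u * Δ ^ (-d)) * s := by
    intro u d hd
    have := (hd s).inv_left.eq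
    rw [zpow_neg, mul_assoc, ← this]
    simp only [mul_assoc]
  have hpow : ∀ (u : G) (k : ℕ), (s⁻¹ * u * s) ^ k = s⁻¹ * u ^ k * s := fun u k => by
    simpa using conj_pow (a := s⁻¹) (b := u) (i := k)
  have hYc : (s⁻¹ * X * s) ^ N * Δ ^ (-c) = s⁻¹ * (X ^ N * Δ ^ (-c)) * s := by
    rw [hpow, hconj _ _ hcc]
  have hTc : cyclingProduct Δ (s⁻¹ * X * s) p N * Δ ^ (-b) =
      s⁻¹ * (cyclingProduct Δ X p N * Δ ^ (-b)) * s := by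
    rw [hs, hconj _ _ hb]
  have hXp : (X ^ N * Δ ^ (-c)) ^ n = (cyclingProduct Δ X p N * Δ ^ (-b)) ^ (n + j) := by
    rw [hXk, mul_comm (n + j) n, hZ.pow_inf hΔ (Nat.le_add_right n j)]
  have hn0 : n ≠ 0 := by omega
  have hj0 : j ≠ 0 := by omega
  have hjn : 1 ≤ j * n := Nat.mul_pos (by omega) (by omega)
  have hrig : IsPureRigid Δ ((cyclingProduct Δ (s⁻¹ * X * s) p N * Δ ^ (-b)) ^ j) (j * n) := by
    refine isPureRigid_pow_of_pow_eq hΔ hcn hcomm hYk ?_ ?_ ?_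
    · rw [hYc, hTc, hpow, hpow, hXp]
    · rw [hTc, hpow]
      intro h
      have h' : (cyclingProduct Δ X p N * Δ ^ (-b)) ^ j = 1 := by
        rw [mul_assoc, inv_mul_eq_one] at h
        simpa using h.symm
      refine hZ.pow_ne_one (k := n * j) (by positivity) ?_
      rw [pow_mul, hXp, ← pow_mul, mul_comm, pow_mul, h', one_pow]
    · rw [hTc, hpow]
      intro h
      have hcjn : Commute (Δ ^ ((j * n : ℕ) : ℤ)) s := by
        rw [mul_comm, Nat.cast_mul, zpow_mul]; exact (hcn s).zpow_left j
      have h' : (cyclingProduct Δ X p N * Δ ^ (-b)) ^ j = Δ ^ ((j * n : ℕ) : ℤ) := by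
        rw [mul_assoc, inv_mul_eq_iff_eq_mul, ← hcjn.eq] at h
        exact mul_right_cancel h
      -- If `t ^ j = Δ ^ (j * n)` then, by `hXk`, this power of `Δ` is a prefix of the `j`-th power
      -- of the rigid element, which has infimum `0`.
      refine hZ.not_le_pow hΔ j ?_
      rw [hXk] at h'
      refine le_trans ?_ (inf_eq_right.1 h')
      simpa using hΔ.zpow_le_zpow (show (1 : ℤ) ≤ (j * n : ℕ) by exact_mod_cast hjn)
  have hcf : ∀ g, Commute (Δ ^ (c * ((n * j : ℕ) : ℤ))) g := fun g => by
    rw [zpow_mul]; exact (hcc g).zpow_left _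
  refine ⟨((N * (n * j) : ℕ) : ℤ), by positivity, ?_⟩
  have hfin := (hrig.pow hΔ (k := n + j) (by omega)).isRigid hΔ hcf
  convert hfin using 1
  have hcN' : Commute ((s⁻¹ * X * s) ^ N) (Δ ^ (-c)) := by
    rw [zpow_neg]; exact (hcc _).symm.inv_right
  have hYp : ((s⁻¹ * X * s) ^ N * Δ ^ (-c)) ^ n =
      (cyclingProduct Δ (s⁻¹ * X * s) p N * Δ ^ (-b)) ^ (n + j) := by
    rw [hYc, hTc, hpow, hpow, hXp]
  rw [← pow_mul, mul_comm j, pow_mul, ← hYp, ← pow_mul, hcN'.mul_pow, ← pow_mul, (hcf _).eq,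
    ← zpow_natCast (Δ ^ (-c)), ← zpow_mul, mul_assoc (_ ^ _), ← zpow_add, zpow_natCast]
  simp

end RigidPower

end Garside

/-! ### Assembly. -/

theorem mainTheorem5 {G : Type*} [Group G] [Lattice G] [MulLeftMono G] (Δ : G)
    (hΔ : Garside.IsGarsideElement Δ) (X : G) (hX : X ∈ Garside.ultraSummitSet Δ X)
    (hlen : 1 < Garside.canonicalLength Δ X) (hrigid : Garside.HasRigidPower Δ X) :
    ∀ Y ∈ Garside.ultraSummitSet Δ X, Garside.HasRigidPower Δ Y := by
  intro Y hY
  -- For `Δ = 1` no normal form exists, so the default value `(0, [])` would give canonical length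
  -- `0`.
  have hne : Δ ≠ 1 := by
    rintro rfl
    have h : ¬ ∃ q : ℤ × List G, Garside.IsLeftNormalForm 1 X q.1 q.2 := by
      rintro ⟨q, hq⟩
      exact hq.not_le_prod hq.one_le_prod
    rw [Garside.canonicalLength, Garside.leftNormalForm, dif_neg h] at hlen
    simp at hlen
  have hXs := hΔ.isSummit_of_mem_superSummitSet hne hX.1
  have hYs := hΔ.isSummit_of_mem_superSummitSet hne hY.1
  have hXY : Garside.canonicalLength Δ Y = Garside.canonicalLength Δ X :=
    le_antisymm (hY.1.2 X (IsConj.refl X)) (hX.1.2 Y hY.1.1)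
  rw [hXY] at hYs
  obtain ⟨s, rfl⟩ : ∃ s, Y = s⁻¹ * X * s := by
    obtain ⟨c, hc⟩ := isConj_iff.1 hY.1.1
    exact ⟨c⁻¹, by simpa using hc.symm⟩
  rw [← hΔ.isSummit_unique hXs hYs] at hYs
  obtain ⟨N₁, hN₁, h₁⟩ := hX.2
  obtain ⟨N₂, hN₂, h₂⟩ := hY.2
  obtain ⟨e, he, hc⟩ := hΔ.exists_zpow_central
  obtain ⟨M, a, n, hM, ha, hZ⟩ := hΔ.exists_isPureRigid_of_hasRigidPower hrigid
  -- The common period is a multiple of `e`, so that the corresponding power of `Δ` is central, and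
  -- of `M`, so that the corresponding power of `X` is a power of `X ^ M`.
  have hPX := (hΔ.isCyclingPeriod (by omega) hXs hN₁ h₁).mul (e * M * N₂)
  have hPY := (hΔ.isCyclingPeriod (by omega) hYs hN₂ h₂).mul (e * M * N₁)
  rw [show e * M * N₁ * N₂ = e * M * N₂ * N₁ by ring] at hPY
  obtain ⟨j, hj, hs⟩ := hΔ.exists_cyclingProduct_conj hPX hPY
  have hk : j * e * N₂ * N₁ ≠ 0 := by positivity
  have hZk := hZ.pow hΔ hk
  have hcomm : Commute (X ^ M) (Δ ^ (-a)) := by rw [zpow_neg]; exact (ha _).symm.inv_right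
  rw [hcomm.mul_pow, ← pow_mul, show M * (j * e * N₂ * N₁) = j * (e * M * N₂ * N₁) by ring,
    ← zpow_natCast (Δ ^ (-a)), ← zpow_mul, neg_mul] at hZk
  refine Garside.hasRigidPower_of_cyclingProduct_conj hΔ hlen hXs (by positivity) ?_ ?_
    (hPX.mul j) (hPY.mul j) hs hZk
  · intro g
    rw [show ((j * (e * M * N₂ * N₁) : ℕ) : ℤ) = e * (j * M * N₂ * N₁ : ℕ) by push_cast; ring,
      zpow_mul]
    exact (hc g).zpow_left _
  · intro g
    rw [zpow_mul]
    exact (ha g).zpow_left _
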